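/- For $p\in(1,\infty)$, $x\in\mathbb R$ and $q\in[0,1)$ let $$F_{1,p}(x,q)=\int_0^{x}\frac{|\cos\theta|^{1-2/p}}{\sqrt{1-q^2\sin^2\theta}}\,d\theta,\qquad E_{1,p}(x,q)=\int_0^{x}\sqrt{1-q^2\sin^2\theta}\,|\cos\theta|^{1-2/p}\,d\theta,$$ $K_{1,p}(q)=F_{1,p}(\pi/2,q)$, $E_{1,p}(q)=E_{1,p}(\pi/2,q)$ and $Q_p(q)=2E_{1,p}(q)/K_{1,p}(q)-1$. Let $\mathrm{am}_{1,p}(\cdot,q)$ be the inverse function of $F_{1,p}(\cdot,q)$, let $\mathrm{cn}_p=|\cos\mathrm{am}_{1,p}|^{2/p-1}\cos\mathrm{am}_{1,p}$, where $|y|^{\alpha}y$ is read as $0$ for $y=0$ (here and below), and let $$\gamma_w(s,q)=\Big(2E_{1,p}(\mathrm{am}_{1,p}(s,q),q)-s,\ -q\tfrac{p}{p-1}|\mathrm{cn}_p(s,q)|^{p-2}\mathrm{cn}_p(s,q)\Big).$$ A half-fold figure-eight $p$-elastica is a plane curve on a compact interval which, up to similarity (translation, rotation, reflection, dilation) and $C^1$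 reparametrization with nowhere vanishing derivative, is given by $s\mapsto\gamma_w(s-K_{1,p}(q),q)$, $s\in[0,2K_{1,p}(q)]$, where $q\in(0,1)$ satisfies $Q_p(q)=0$. **Theorem 1.3 (Monotonicity of the crossing angle).** For every $p\in(1,\infty)$ the equation $2E_{1,p}(q)/K_{1,p}(q)=1$ has exactly one solution $q=q^*(p)$ in $(0,1)$. Put $\phi^*(p)=\pi-2\arcsin q^*(p)$. For every $p\in(1,\infty)$, half-fold figure-eight $p$-elasticae exist, each of them has nonzero tangent vectors at its two endpoints, and the angle between these two vectors is $2\phi^*(p)$. The function $\phi^*$ is continuous, indeed $C^1$, and strictly decreasing on $(1,\infty)$, with $\phi^*(p)\to\pi/2$ as $p\downarrow1$ and $\phi^*(p)\to0$ as $p\to\infty$. Moreover, for each $q\in(0,1)$ the function $p\mapsto Q_p(q)$ is strictly increasing on $(1,\infty)$. -/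

import Mathlib

noncomputable section

namespace PElastica

/-- The incomplete `p`-elliptic integral of the first kind `F_{1,p}(x, q)`, of modulus `q`. -/
def F (p x q : ℝ) : ℝ :=
  ∫ θ in (0 : ℝ)..x, |Real.cos θ| ^ (1 - 2 / p) / √(1 - q ^ 2 * Real.sin θ ^ 2)

/-- The complete `p`-elliptic integral of the first kind `K_{1,p}(q)`. -/
def K (p q : ℝ) : ℝ := F p (Real.pi / 2) q

/-- The incomplete `p`-elliptic integral of the second kind `E_{1,p}(x, q)`, of modulus `q`. -/
def EInc (p x q : ℝ) : ℝ :=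
  ∫ θ in (0 : ℝ)..x, √(1 - q ^ 2 * Real.sin θ ^ 2) * |Real.cos θ| ^ (1 - 2 / p)

/-- The complete `p`-elliptic integral of the second kind `E_{1,p}(q)`. -/
def E (p q : ℝ) : ℝ := EInc p (Real.pi / 2) q

/-- The function `Q_p(q) = 2 E_{1,p}(q) / K_{1,p}(q) - 1`. -/
def Q (p q : ℝ) : ℝ := 2 * (E p q / K p q) - 1

open Classical in
/-- The modulus `q*(p) ∈ (0,1)` of the figure-eight: the root of `Q_p` in `(0,1)`.
(That there is exactly one root for `p > 1` is part of the theorem; the value `0` is a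
placeholder for the case that there is no root.) -/
def qStar (p : ℝ) : ℝ :=
  if h : ∃ q : ℝ, q ∈ Set.Ioo (0 : ℝ) 1 ∧ Q p q = 0 then h.choose else 0

/-- The angle `φ*(p) = π - 2 arcsin q*(p)`. -/
def phiStar (p : ℝ) : ℝ := Real.pi - 2 * Real.arcsin (qStar p)

/-- The amplitude function `am_{1,p}(·, q)`, the inverse function of `x ↦ F_{1,p}(x, q)`
(a bijection of `ℝ` for `p > 1` and `0 ≤ q < 1`). -/
def am (p s q : ℝ) : ℝ := Function.invFun (fun x : ℝ => F p x q) s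

/-- The `p`-elliptic cosine `cn_p(s, q)`. -/
def cn (p s q : ℝ) : ℝ :=
  |Real.cos (am p s q)| ^ (2 / p - 1) * Real.cos (am p s q)

/-- The arclength parametrized wavelike `p`-elastica `γ_w(s, q)` of modulus `q`. -/
def wavelike (p s q : ℝ) : EuclideanSpace ℝ (Fin 2) :=
  !₂[2 * EInc p (am p s q) q - s,
     -(q * (p / (p - 1)) * |cn p s q| ^ (p - 2) * cn p s q)]

/-- `γ`, regarded as a curve on `[a, b]`, is a half-fold figure-eight `p`-elastica: up to
similarity (translation by `v`, dilation by `c`, rotation or reflection `A`) and `C¹`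
reparametrization `σ` (of either orientation) it is the curve
`s ↦ γ_w(s - K_{1,p}(q), q)`, `s ∈ [0, 2 K_{1,p}(q)]`, with `q ∈ (0,1)` such that
`2 E_{1,p}(q) / K_{1,p}(q) - 1 = 0`. -/
def IsHalfFoldFigureEight (p a b : ℝ) (γ : ℝ → EuclideanSpace ℝ (Fin 2)) : Prop :=
  a < b ∧
  ∃ q ∈ Set.Ioo (0 : ℝ) 1, Q p q = 0 ∧
  ∃ (v : EuclideanSpace ℝ (Fin 2)) (c : ℝ)
    (A : EuclideanSpace ℝ (Fin 2) ≃ₗᵢ[ℝ] EuclideanSpace ℝ (Fin 2)) (σ : ℝ → ℝ),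
    0 < c ∧
    ContDiffOn ℝ 1 σ (Set.Icc a b) ∧
    (∀ t ∈ Set.Icc a b, derivWithin σ (Set.Icc a b) t ≠ 0) ∧
    Set.BijOn σ (Set.Icc a b) (Set.Icc 0 (2 * K p q)) ∧
    ∀ t ∈ Set.Icc a b, γ t = v + c • A (wavelike p (σ t - K p q) q)

end PElastica

end

noncomputable section

open MeasureTheory Set Filter Topology Real

namespace PElastica

/-! Put `a = 1 - 2/p`, which increases from `-1` to `1` with `p`, and Δ = √(1 - q² sin²θ). The sign
of `Q` is that of `2E - K`, the integral of cos^a θ (2Δ - 1/Δ) over (0, π/2), called `intFig a q`.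
Since Δ decreases in `q`, so does this integral. Moreover 2Δ - 1/Δ = (1 - 2q² + 2q² cos²θ)/Δ, so `Q`
is 1 - 2q² plus 2q² times the mean of cos² for the weight cos^a/Δ. Raising `a` shifts mass towards
large cosines, so `Q` increases with `p` (`integral_pos_of_exponent_lt`).

At `q = 0` the integral is positive. As `q` tends to 1 with exponent `b ∈ (0,1)` it has a negative
limit by a Wallis recursion, and monotonicity in the exponent carries the negative sign down to
smaller exponents (`exists_intFig_neg`). Hence there is exactly one root, and it increases with `p`;
the implicit function theorem makes it C¹ (`hasDerivAt_qStar`). As `a` tends to `-1` the weight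
concentrates at θ = π/2, where cos² vanishes, so the root tends to the zero 1/√2 of 1 - 2q². At `a =
1` the integral equals √(1 - q²), positive for all `q < 1`, which pushes the root to 1.

In terms of the amplitude θ the velocity of the curve is (2Δ² - 1, 2q sin θ Δ). With q* = sin α the
values at θ = ±π/2 are (cos 2α, ±sin 2α), and α > π/4 makes the angle between them 2π - 4α = 2φ*. At
θ = ±π/2 the integrand of `F` may vanish or blow up, so these one-sided derivatives come from
L'Hôpital's rule (`hasDerivWithinAt_comp_am`). -/

/-! ### Powers of the cosine on the quarter period -/

lemma cos_pos_of_mem_quarter {θ : ℝ} (h : θ ∈ Ioo 0 (π / 2)) : 0 < cos θ :=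
  cos_pos_of_mem_Ioo ⟨by linarith [h.1, pi_pos], h.2⟩

lemma sin_pos_of_mem_quarter {θ : ℝ} (h : θ ∈ Ioo 0 (π / 2)) : 0 < sin θ :=
  sin_pos_of_pos_of_lt_pi h.1 (by linarith [h.2, pi_pos])

lemma continuousOn_cos_rpow (a : ℝ) : ContinuousOn (fun θ => cos θ ^ a) (Ioo 0 (π / 2)) :=
  continuous_cos.continuousOn.rpow_const fun _ hθ => Or.inl (cos_pos_of_mem_quarter hθ).ne'

lemma hasDerivAt_cos_rpow {a θ : ℝ} (h : 0 < cos θ) :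
    HasDerivAt (fun θ => -(cos θ ^ (a + 1))) ((a + 1) * (cos θ ^ a * sin θ)) θ := by
  have := ((hasDerivAt_cos θ).rpow_const (p := a + 1) (Or.inl h.ne')).neg
  convert! this using 1
  simp; ring

lemma continuousOn_neg_cos_rpow {a : ℝ} (ha : -1 < a) :
    ContinuousOn (fun θ => -(cos θ ^ (a + 1))) (Icc 0 (π / 2)) :=
  (continuous_cos.continuousOn.rpow_const fun _ _ => Or.inr (by linarith)).neg

/-- For `a < 0` the integrand is unbounded at π/2. It is integrable as the nonnegative derivative,
up to the factor `a + 1`, of a function continuous up to the endpoint. -/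
lemma integrableOn_cos_rpow_mul_sin {a : ℝ} (ha : -1 < a) :
    IntegrableOn (fun θ => cos θ ^ a * sin θ) (Ioc 0 (π / 2)) := by
  have h := intervalIntegral.integrableOn_deriv_of_nonneg (continuousOn_neg_cos_rpow ha)
    (fun θ hθ => hasDerivAt_cos_rpow (a := a) (cos_pos_of_mem_quarter hθ))
    (fun θ hθ => mul_nonneg (by linarith)
      (mul_nonneg (rpow_nonneg (cos_pos_of_mem_quarter hθ).le _) (sin_pos_of_mem_quarter hθ).le))
  have h2 := h.const_mul (a + 1)⁻¹
  refine h2.congr (ae_of_all _ fun θ => ?_)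
  have : a + 1 ≠ 0 := by linarith
  simp only []
  field_simp

lemma setIntegral_cos_rpow_mul_sin {a : ℝ} (ha : -1 < a) :
    ∫ θ in Ioo 0 (π / 2), cos θ ^ a * sin θ = 1 / (a + 1) := by
  have hne : a + 1 ≠ 0 := by linarith
  have h := intervalIntegral.integral_eq_sub_of_hasDerivAt_of_le (by positivity)
    (continuousOn_neg_cos_rpow ha)
    (fun θ hθ => hasDerivAt_cos_rpow (a := a) (cos_pos_of_mem_quarter hθ))
    ((intervalIntegrable_iff_integrableOn_Ioc_of_le (by positivity)).2
      ((integrableOn_cos_rpow_mul_sin ha).const_mul (a + 1)))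
  rw [intervalIntegral.integral_of_le (by positivity), integral_Ioc_eq_integral_Ioo,
    integral_const_mul] at h
  rw [eq_div_iff hne, mul_comm, h]
  simp [zero_rpow hne]

/-- Splitting 1 = cos² + sin² gives cos^a ≤ cos^(a+2) + cos^a sin ≤ 1 + cos^a sin, and the last term
has an explicit antiderivative. -/
lemma integrableOn_cos_rpow {a : ℝ} (ha : -1 < a) :
    IntegrableOn (fun θ => cos θ ^ a) (Ioo 0 (π / 2)) := by
  have hb : IntegrableOn (fun θ => 1 + cos θ ^ a * sin θ) (Ioo 0 (π / 2)) :=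
    (integrableOn_const (by simp)).add
      ((integrableOn_cos_rpow_mul_sin ha).mono_set Ioo_subset_Ioc_self)
  refine hb.mono' ((continuousOn_cos_rpow a).aestronglyMeasurable measurableSet_Ioo) ?_
  refine (ae_restrict_mem measurableSet_Ioo).mono fun θ hθ => ?_
  have hc := cos_pos_of_mem_quarter hθ
  have hs := sin_pos_of_mem_quarter hθ
  have hp := rpow_pos_of_pos hc a
  rw [norm_of_nonneg hp.le]
  have h1 : cos θ ^ (a + 2) ≤ 1 := rpow_le_one hc.le (cos_le_one θ) (by linarith)
  have h2 : cos θ ^ (a + 2) = cos θ ^ a * cos θ ^ 2 := by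
    rw [rpow_add hc]; norm_cast
  have h3 : cos θ ^ a * sin θ ^ 2 ≤ cos θ ^ a * sin θ := by
    apply mul_le_mul_of_nonneg_left _ hp.le
    nlinarith [sin_le_one θ]
  nlinarith [sin_sq_add_cos_sq θ]

/-! ### Integrals depending on the exponent and the modulus -/

/-- The integrand of the weighted integrals `∫ cos^a (log cos)^j k(q, ·)` over the quarter period. -/
def weighted (j : ℕ) (k : ℝ → ℝ → ℝ) (a q θ : ℝ) : ℝ := cos θ ^ a * log (cos θ) ^ j * k q θ

/-- Powers of the logarithm cost only an arbitrarily small negative power of the cosine. -/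
lemma abs_log_pow_le (j : ℕ) {t c : ℝ} (ht : 0 < t) (hc : 0 < c) (hc1 : c ≤ 1) :
    |log c| ^ j ≤ t⁻¹ ^ j * c ^ (-(t * j)) := by
  have h1 := abs_log_mul_self_rpow_lt c t hc hc1 ht
  have hp := rpow_pos_of_pos hc t
  rw [abs_mul, abs_of_pos hp, one_div] at h1
  have h2 : |log c| ≤ t⁻¹ * c ^ (-t) := by
    rw [rpow_neg hc.le, ← div_eq_mul_inv, le_div_iff₀ hp]; exact h1.le
  calc |log c| ^ j ≤ (t⁻¹ * c ^ (-t)) ^ j := pow_le_pow_left₀ (abs_nonneg _) h2 j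
    _ = _ := by rw [mul_pow, ← rpow_natCast (c ^ (-t)), ← rpow_mul hc.le]; ring_nf

lemma exists_bound_of_continuousOn {k : ℝ → ℝ → ℝ}
    (hk : ContinuousOn (Function.uncurry k) (Ioo (-1) 1 ×ˢ univ)) {q₀ : ℝ} (hq : q₀ ∈ Ioo (-1 : ℝ) 1) :
    ∃ M, 0 ≤ M ∧ ∀ᶠ q in 𝓝 q₀, q ∈ Ioo (-1 : ℝ) 1 ∧ ∀ θ ∈ Ioo 0 (π / 2), |k q θ| ≤ M := by
  obtain ⟨l, hl1, hl2⟩ := exists_between hq.1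
  obtain ⟨r, hr1, hr2⟩ := exists_between hq.2
  have hcomp : IsCompact (Icc l r ×ˢ Icc 0 (π / 2)) := isCompact_Icc.prod isCompact_Icc
  obtain ⟨M, hM⟩ := hcomp.exists_bound_of_continuousOn (f := Function.uncurry k)
    (hk.mono (prod_mono (fun x hx => ⟨by linarith [hx.1], by linarith [hx.2]⟩) (subset_univ _)))
  refine ⟨|M|, abs_nonneg _, Filter.mem_of_superset (Ioo_mem_nhds hl2 hr1) fun q hq' => ⟨⟨?_, ?_⟩, fun θ hθ => ?_⟩⟩
  · linarith [hq'.1]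
  · linarith [hq'.2]
  · exact (hM (q, θ) ⟨Ioo_subset_Icc_self hq', Ioo_subset_Icc_self hθ⟩).trans (le_abs_self M)

/-- One integrable majorant, uniform near `(a₀, q₀)`, serves the continuity of the integrals and
their differentiation in either parameter. -/
lemma exists_bound_weighted (j : ℕ) {k : ℝ → ℝ → ℝ}
    (hk : ContinuousOn (Function.uncurry k) (Ioo (-1) 1 ×ˢ univ)) {a₀ q₀ : ℝ} (ha : -1 < a₀)
    (hq : q₀ ∈ Ioo (-1 : ℝ) 1) :
    ∃ bound : ℝ → ℝ, IntegrableOn bound (Ioo 0 (π / 2)) ∧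
      ∀ᶠ v : ℝ × ℝ in 𝓝 (a₀, q₀), ∀ θ ∈ Ioo 0 (π / 2), ‖weighted j k v.1 v.2 θ‖ ≤ bound θ := by
  obtain ⟨M, hM0, hM⟩ := exists_bound_of_continuousOn hk hq
  -- One `δ` pays for varying the exponent and one for the logarithms; `a₀ - 2δ` is still above
  -- `-1`.
  set δ := (a₀ + 1) / 4 with hδ
  have hδ0 : 0 < δ := by linarith
  set t := δ / (j + 1) with ht
  have ht0 : 0 < t := by positivity
  have htj : t * j ≤ δ := by
    rw [ht, div_mul_eq_mul_div, div_le_iff₀ (by positivity)]; nlinarith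
  refine ⟨fun θ => t⁻¹ ^ j * M * cos θ ^ (a₀ - 2 * δ),
    (integrableOn_cos_rpow (by linarith)).const_mul _, ?_⟩
  have h1 : ∀ᶠ v : ℝ × ℝ in 𝓝 (a₀, q₀), a₀ - δ < v.1 :=
    continuousAt_fst.eventually (lt_mem_nhds (by simp; linarith))
  have h2 := (continuousAt_snd (p := (a₀, q₀))).eventually hM
  filter_upwards [h1, h2] with v hv1 hv2 θ hθ
  have hc := cos_pos_of_mem_quarter hθ
  rw [weighted, norm_mul, norm_mul, norm_of_nonneg (rpow_nonneg hc.le _), norm_pow, norm_eq_abs,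
    norm_eq_abs]
  have h3 := abs_log_pow_le j ht0 hc (cos_le_one θ)
  have h4 := hv2.2 θ hθ
  calc cos θ ^ v.1 * |log (cos θ)| ^ j * |k v.2 θ|
      ≤ cos θ ^ (a₀ - δ) * (t⁻¹ ^ j * cos θ ^ (-(t * j))) * M := by
        gcongr ?_ * ?_ * ?_
        exact rpow_le_rpow_of_exponent_ge hc (cos_le_one θ) hv1.le
    _ = t⁻¹ ^ j * M * cos θ ^ (a₀ - δ - t * j) := by
        rw [sub_eq_add_neg (a₀ - δ), rpow_add hc]; ring
    _ ≤ t⁻¹ ^ j * M * cos θ ^ (a₀ - 2 * δ) := by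
        gcongr ?_ * ?_
        exact rpow_le_rpow_of_exponent_ge hc (cos_le_one θ) (by linarith)

lemma continuousOn_weighted (j : ℕ) {k : ℝ → ℝ → ℝ}
    (hk : ContinuousOn (Function.uncurry k) (Ioo (-1) 1 ×ˢ univ)) (a : ℝ) {q : ℝ}
    (hq : q ∈ Ioo (-1 : ℝ) 1) : ContinuousOn (weighted j k a q) (Ioo 0 (π / 2)) := by
  refine ((continuousOn_cos_rpow a).mul ((ContinuousOn.log continuous_cos.continuousOn
    fun θ hθ => (cos_pos_of_mem_quarter hθ).ne').pow j)).mul ?_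
  exact hk.comp (f := fun θ => (q, θ)) (by fun_prop) fun θ _ => ⟨hq, mem_univ _⟩

lemma aestronglyMeasurable_weighted (j : ℕ) {k : ℝ → ℝ → ℝ}
    (hk : ContinuousOn (Function.uncurry k) (Ioo (-1) 1 ×ˢ univ)) (a : ℝ) {q : ℝ}
    (hq : q ∈ Ioo (-1 : ℝ) 1) :
    AEStronglyMeasurable (weighted j k a q) (volume.restrict (Ioo 0 (π / 2))) :=
  (continuousOn_weighted j hk a hq).aestronglyMeasurable measurableSet_Ioo

lemma integrableOn_weighted (j : ℕ) {k : ℝ → ℝ → ℝ}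
    (hk : ContinuousOn (Function.uncurry k) (Ioo (-1) 1 ×ˢ univ)) {a q : ℝ} (ha : -1 < a)
    (hq : q ∈ Ioo (-1 : ℝ) 1) : IntegrableOn (weighted j k a q) (Ioo 0 (π / 2)) := by
  obtain ⟨b, hb, h⟩ := exists_bound_weighted j hk ha hq
  exact hb.mono' (aestronglyMeasurable_weighted j hk a hq)
    ((ae_restrict_mem measurableSet_Ioo).mono h.self_of_nhds)

lemma continuousAt_integral_weighted (j : ℕ) {k : ℝ → ℝ → ℝ}
    (hk : ContinuousOn (Function.uncurry k) (Ioo (-1) 1 ×ˢ univ)) {a₀ q₀ : ℝ} (ha : -1 < a₀)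
    (hq : q₀ ∈ Ioo (-1 : ℝ) 1) :
    ContinuousAt (fun v : ℝ × ℝ => ∫ θ in Ioo 0 (π / 2), weighted j k v.1 v.2 θ) (a₀, q₀) := by
  obtain ⟨b, hb, h⟩ := exists_bound_weighted j hk ha hq
  refine continuousAt_of_dominated (bound := b) ?_ ?_ hb ?_
  · have := (continuousAt_snd (p := (a₀, q₀))).eventually (Ioo_mem_nhds hq.1 hq.2)
    exact this.mono fun v hv => aestronglyMeasurable_weighted j hk _ hv
  · exact h.mono fun v hv => (ae_restrict_mem measurableSet_Ioo).mono hv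
  · refine (ae_restrict_mem measurableSet_Ioo).mono fun θ hθ => ?_
    have hc := cos_pos_of_mem_quarter hθ
    refine ContinuousAt.mul (ContinuousAt.mul ?_ continuousAt_const) ?_
    · exact continuousAt_const.rpow continuousAt_fst (Or.inl hc.ne')
    · have h1 : ContinuousAt (Function.uncurry k) (q₀, θ) :=
        hk.continuousAt (prod_mem_nhds (Ioo_mem_nhds hq.1 hq.2) univ_mem)
      exact ContinuousAt.comp (f := fun v : ℝ × ℝ => (v.2, θ)) (x := (a₀, q₀)) h1 (by fun_prop)

lemma hasDerivAt_integral_weighted_exponent (j : ℕ) {k : ℝ → ℝ → ℝ}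
    (hk : ContinuousOn (Function.uncurry k) (Ioo (-1) 1 ×ˢ univ)) {a₀ q₀ : ℝ} (ha : -1 < a₀)
    (hq : q₀ ∈ Ioo (-1 : ℝ) 1) :
    HasDerivAt (fun a => ∫ θ in Ioo 0 (π / 2), weighted j k a q₀ θ)
      (∫ θ in Ioo 0 (π / 2), weighted (j + 1) k a₀ q₀ θ) a₀ := by
  obtain ⟨b, hb, h⟩ := exists_bound_weighted (j + 1) hk ha hq
  have h' : ∀ᶠ a in 𝓝 a₀, ∀ θ ∈ Ioo 0 (π / 2), ‖weighted (j + 1) k a q₀ θ‖ ≤ b θ :=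
    (Continuous.prodMk_left q₀).continuousAt.eventually h
  refine (hasDerivAt_integral_of_dominated_loc_of_deriv_le (bound := b) h'
    (F' := fun a θ => weighted (j + 1) k a q₀ θ)
    (.of_forall fun a => aestronglyMeasurable_weighted j hk a hq)
    (integrableOn_weighted j hk ha hq) (aestronglyMeasurable_weighted (j + 1) hk a₀ hq) ?_ hb ?_).2
  · exact (ae_restrict_mem measurableSet_Ioo).mono fun θ hθ a ha => ha θ hθ
  · refine (ae_restrict_mem measurableSet_Ioo).mono fun θ hθ a _ => ?_
    have hc := cos_pos_of_mem_quarter hθ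
    have := (((hasStrictDerivAt_const_rpow hc a).hasDerivAt).mul_const (log (cos θ) ^ j)).mul_const
      (k q₀ θ)
    convert! this using 1
    simp only [weighted]; ring

lemma hasDerivAt_integral_weighted_modulus (j : ℕ) {k k' : ℝ → ℝ → ℝ}
    (hk : ContinuousOn (Function.uncurry k) (Ioo (-1) 1 ×ˢ univ))
    (hk' : ContinuousOn (Function.uncurry k') (Ioo (-1) 1 ×ˢ univ))
    (hkk' : ∀ q ∈ Ioo (-1 : ℝ) 1, ∀ θ, HasDerivAt (k · θ) (k' q θ) q)
    {a₀ q₀ : ℝ} (ha : -1 < a₀) (hq : q₀ ∈ Ioo (-1 : ℝ) 1) :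
    HasDerivAt (fun q => ∫ θ in Ioo 0 (π / 2), weighted j k a₀ q θ)
      (∫ θ in Ioo 0 (π / 2), weighted j k' a₀ q₀ θ) q₀ := by
  obtain ⟨b, hb, h⟩ := exists_bound_weighted j hk' ha hq
  have h' : ∀ᶠ q in 𝓝 q₀, ∀ θ ∈ Ioo 0 (π / 2), ‖weighted j k' a₀ q θ‖ ≤ b θ :=
    (Continuous.prodMk_right a₀).continuousAt.eventually h
  have hq' := Ioo_mem_nhds hq.1 hq.2
  refine (hasDerivAt_integral_of_dominated_loc_of_deriv_le (bound := b) (inter_mem h' hq')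
    (F' := fun q θ => weighted j k' a₀ q θ)
    (Filter.mem_of_superset hq' fun q hq => aestronglyMeasurable_weighted j hk a₀ hq)
    (integrableOn_weighted j hk ha hq) (aestronglyMeasurable_weighted j hk' a₀ hq) ?_ hb ?_).2
  · exact (ae_restrict_mem measurableSet_Ioo).mono fun θ hθ q hq => hq.1 θ hθ
  · exact ae_of_all _ fun θ q hq => (hkk' q hq.2 θ).const_mul _

/-! ### The kernels and the complete integrals -/

/-- Legendre's `Δ(q, θ)`. -/
def modular (q θ : ℝ) : ℝ := √(1 - q ^ 2 * sin θ ^ 2)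

lemma one_sub_sq_mul_sin_sq_pos {q : ℝ} (hq : q ∈ Ioo (-1 : ℝ) 1) (θ : ℝ) :
    0 < 1 - q ^ 2 * sin θ ^ 2 := by
  have h1 : q ^ 2 < 1 := by nlinarith [hq.1, hq.2]
  nlinarith [sin_sq_le_one θ, sq_nonneg q, sq_nonneg (sin θ)]

lemma modular_pos {q : ℝ} (hq : q ∈ Ioo (-1 : ℝ) 1) (θ : ℝ) : 0 < modular q θ :=
  sqrt_pos.2 (one_sub_sq_mul_sin_sq_pos hq θ)

lemma modular_sq {q : ℝ} (hq : q ∈ Ioo (-1 : ℝ) 1) (θ : ℝ) :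
    modular q θ ^ 2 = 1 - q ^ 2 * sin θ ^ 2 :=
  sq_sqrt (one_sub_sq_mul_sin_sq_pos hq θ).le

lemma modular_le_one (q θ : ℝ) : modular q θ ≤ 1 :=
  sqrt_le_one.2 (by nlinarith [mul_nonneg (sq_nonneg q) (sq_nonneg (sin θ))])

lemma continuous_modular : Continuous (Function.uncurry modular) := by
  unfold modular Function.uncurry; fun_prop

lemma hasDerivAt_modular {q : ℝ} (hq : q ∈ Ioo (-1 : ℝ) 1) (θ : ℝ) :
    HasDerivAt (modular · θ) (-(q * sin θ ^ 2) / modular q θ) q := by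
  have h := (((hasDerivAt_pow 2 q).mul_const (sin θ ^ 2)).const_sub 1).sqrt
    (one_sub_sq_mul_sin_sq_pos hq θ).ne'
  convert! h using 1
  simp only [modular]
  field_simp
  simp [mul_comm, mul_left_comm]

/-- The integrand of `K` without its weight. -/
def kerK (q θ : ℝ) : ℝ := 1 / modular q θ

/-- The integrand of `2E - K` without its weight. -/
def kerFig (q θ : ℝ) : ℝ := 2 * modular q θ - 1 / modular q θ

/-- The derivative of `kerFig` with respect to the modulus. -/
def kerFig' (q θ : ℝ) : ℝ := -(q * sin θ ^ 2) * (2 / modular q θ + 1 / modular q θ ^ 3)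

lemma continuousOn_kerK : ContinuousOn (Function.uncurry kerK) (Ioo (-1) 1 ×ˢ univ) :=
  continuousOn_const.div continuous_modular.continuousOn fun x hx => (modular_pos hx.1 x.2).ne'

lemma continuousOn_kerFig : ContinuousOn (Function.uncurry kerFig) (Ioo (-1) 1 ×ˢ univ) :=
  (continuous_modular.continuousOn.const_mul 2).sub continuousOn_kerK

lemma continuousOn_kerFig' : ContinuousOn (Function.uncurry kerFig') (Ioo (-1) 1 ×ˢ univ) := by
  have h : ∀ x ∈ Ioo (-1 : ℝ) 1 ×ˢ (univ : Set ℝ), modular x.1 x.2 ≠ 0 :=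
    fun x hx => (modular_pos hx.1 x.2).ne'
  refine ContinuousOn.mul (f := fun x : ℝ × ℝ => -(x.1 * sin x.2 ^ 2)) (by fun_prop) ?_
  exact (continuousOn_const.div continuous_modular.continuousOn h).add
    (continuousOn_const.div (continuous_modular.continuousOn.pow 3) fun x hx => pow_ne_zero _ (h x hx))

lemma hasDerivAt_kerFig {q : ℝ} (hq : q ∈ Ioo (-1 : ℝ) 1) (θ : ℝ) :
    HasDerivAt (kerFig · θ) (kerFig' q θ) q := by
  have hD := (modular_pos hq θ).ne'
  have h := ((hasDerivAt_modular hq θ).const_mul 2).sub ((hasDerivAt_modular hq θ).inv hD)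
  convert! h using 1
  · ext x; simp [kerFig]
  · simp only [kerFig']; field_simp; ring

/-- `K_{1,p}(q)` in terms of the exponent `a = 1 - 2 / p`. -/
def intK (a q : ℝ) : ℝ := ∫ θ in Ioo 0 (π / 2), weighted 0 kerK a q θ

/-- `2 E_{1,p}(q) - K_{1,p}(q)` in terms of the exponent `a = 1 - 2 / p`. -/
def intFig (a q : ℝ) : ℝ := ∫ θ in Ioo 0 (π / 2), weighted 0 kerFig a q θ

lemma setIntegral_pos_of_pos {f : ℝ → ℝ} (hf : IntegrableOn f (Ioo 0 (π / 2)))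
    (h : ∀ θ ∈ Ioo 0 (π / 2), 0 < f θ) : 0 < ∫ θ in Ioo 0 (π / 2), f θ := by
  rw [setIntegral_pos_iff_support_of_nonneg_ae _ hf]
  · have hs : Ioo 0 (π / 2) ⊆ Function.support f := fun θ hθ => (h θ hθ).ne'
    rw [inter_eq_right.2 hs]
    simp [pi_pos]
  · exact (ae_restrict_mem measurableSet_Ioo).mono fun θ hθ => (h θ hθ).le

lemma weighted_zero (k : ℝ → ℝ → ℝ) (a q θ : ℝ) : weighted 0 k a q θ = cos θ ^ a * k q θ := by
  simp [weighted]

lemma intK_pos {a q : ℝ} (ha : -1 < a) (hq : q ∈ Ioo (-1 : ℝ) 1) : 0 < intK a q := by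
  refine setIntegral_pos_of_pos (integrableOn_weighted 0 continuousOn_kerK ha hq) fun θ hθ => ?_
  rw [weighted_zero]
  exact mul_pos (rpow_pos_of_pos (cos_pos_of_mem_quarter hθ) _) (one_div_pos.2 (modular_pos hq θ))

lemma exponent_mem {p : ℝ} (hp : 1 < p) : 1 - 2 / p ∈ Ioo (-1 : ℝ) 1 := by
  have : 2 / p < 2 := by rw [div_lt_iff₀] <;> linarith
  have : 0 < 2 / p := by positivity
  constructor <;> linarith

lemma F_eq {p x q : ℝ} :
    F p x q = ∫ θ in (0 : ℝ)..x, |cos θ| ^ (1 - 2 / p) / modular q θ := rfl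

lemma EInc_eq {p x q : ℝ} :
    EInc p x q = ∫ θ in (0 : ℝ)..x, modular q θ * |cos θ| ^ (1 - 2 / p) := rfl

lemma K_eq {p q : ℝ} : K p q = intK (1 - 2 / p) q := by
  rw [K, F_eq, intervalIntegral.integral_of_le (by positivity), integral_Ioc_eq_integral_Ioo, intK]
  refine setIntegral_congr_fun measurableSet_Ioo fun θ hθ => ?_
  simp only [weighted_zero, kerK, abs_of_pos (cos_pos_of_mem_quarter hθ)]
  ring

lemma continuousOn_uncurry_modular :
    ContinuousOn (Function.uncurry modular) (Ioo (-1) 1 ×ˢ univ) :=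
  continuous_modular.continuousOn

lemma E_eq {p q : ℝ} : E p q = ∫ θ in Ioo 0 (π / 2), weighted 0 modular (1 - 2 / p) q θ := by
  rw [E, EInc_eq, intervalIntegral.integral_of_le (by positivity), integral_Ioc_eq_integral_Ioo]
  refine setIntegral_congr_fun measurableSet_Ioo fun θ hθ => ?_
  simp only [weighted_zero, abs_of_pos (cos_pos_of_mem_quarter hθ)]
  ring

lemma two_mul_E_sub_K {p q : ℝ} (hp : 1 < p) (hq : q ∈ Ioo (-1 : ℝ) 1) :
    2 * E p q - K p q = intFig (1 - 2 / p) q := by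
  have ha := (exponent_mem hp).1
  rw [K_eq, E_eq, intK, intFig, ← integral_const_mul, ← integral_sub
    ((integrableOn_weighted 0 continuousOn_uncurry_modular ha hq).const_mul 2)
    (integrableOn_weighted 0 continuousOn_kerK ha hq)]
  refine integral_congr_ae (ae_of_all _ fun θ => ?_)
  simp only [weighted_zero, kerFig, kerK]
  ring

lemma Q_eq {p q : ℝ} (hp : 1 < p) (hq : q ∈ Ioo (-1 : ℝ) 1) :
    Q p q = intFig (1 - 2 / p) q / intK (1 - 2 / p) q := by
  have hK : K p q ≠ 0 := by rw [K_eq]; exact (intK_pos (exponent_mem hp).1 hq).ne'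
  rw [← two_mul_E_sub_K hp hq, ← K_eq, Q]
  field_simp

lemma K_pos {p q : ℝ} (hp : 1 < p) (hq : q ∈ Ioo (-1 : ℝ) 1) : 0 < K p q := by
  rw [K_eq]; exact intK_pos (exponent_mem hp).1 hq

lemma Ioo_zero_one_subset : Ioo (0 : ℝ) 1 ⊆ Ioo (-1) 1 := Ioo_subset_Ioo_left (by norm_num)

/-! ### Monotonicity in the modulus -/

/-- The derivative of `intFig` with respect to the modulus. -/
def intFigModulus (a q : ℝ) : ℝ := ∫ θ in Ioo 0 (π / 2), weighted 0 kerFig' a q θ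

/-- The derivative of `intFig` with respect to the exponent. -/
def intFigExponent (a q : ℝ) : ℝ := ∫ θ in Ioo 0 (π / 2), weighted 1 kerFig a q θ

lemma hasDerivAt_intFig_modulus {a q : ℝ} (ha : -1 < a) (hq : q ∈ Ioo (-1 : ℝ) 1) :
    HasDerivAt (intFig a) (intFigModulus a q) q :=
  hasDerivAt_integral_weighted_modulus 0 continuousOn_kerFig continuousOn_kerFig'
    (fun _ => hasDerivAt_kerFig) ha hq

lemma hasDerivAt_intFig_exponent {a q : ℝ} (ha : -1 < a) (hq : q ∈ Ioo (-1 : ℝ) 1) :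
    HasDerivAt (intFig · q) (intFigExponent a q) a :=
  hasDerivAt_integral_weighted_exponent 0 continuousOn_kerFig ha hq

lemma intFigModulus_neg {a q : ℝ} (ha : -1 < a) (hq : q ∈ Ioo (0 : ℝ) 1) :
    intFigModulus a q < 0 := by
  have hq' := Ioo_zero_one_subset hq
  rw [← neg_pos, intFigModulus, ← integral_neg]
  refine setIntegral_pos_of_pos (integrableOn_weighted 0 continuousOn_kerFig' ha hq').neg
    fun θ hθ => ?_
  have hD := modular_pos hq' θ
  have := rpow_pos_of_pos (cos_pos_of_mem_quarter hθ) a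
  have := sin_pos_of_mem_quarter hθ
  have := hq.1
  rw [weighted_zero, kerFig', neg_mul, mul_neg, neg_neg]
  positivity

lemma strictAntiOn_intFig {a : ℝ} (ha : -1 < a) : StrictAntiOn (intFig a) (Ioo 0 1) := by
  refine strictAntiOn_of_deriv_neg (convex_Ioo 0 1) (fun q hq =>
    (hasDerivAt_intFig_modulus ha (Ioo_zero_one_subset hq)).continuousAt.continuousWithinAt)
    fun q hq => ?_
  rw [interior_Ioo] at hq
  rw [(hasDerivAt_intFig_modulus ha (Ioo_zero_one_subset hq)).deriv]
  exact intFigModulus_neg ha hq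

/-! ### Monotonicity in the exponent -/

lemma kerFig_eq {q : ℝ} (hq : q ∈ Ioo (-1 : ℝ) 1) (θ : ℝ) :
    kerFig q θ = (1 - 2 * q ^ 2 + 2 * q ^ 2 * cos θ ^ 2) * kerK q θ := by
  have hD := (modular_pos hq θ).ne'
  rw [kerFig, kerK]
  field_simp
  rw [modular_sq hq, sin_sq]; ring

/-- Chebyshev-type monotonicity: if a combination of `1` and `cos²` has mean zero
for one exponent, then it has a positive mean for every larger exponent. -/
lemma integral_pos_of_exponent_lt {a b q κ : ℝ} (ha : -1 < a) (hab : a < b)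
    (hq : q ∈ Ioo (0 : ℝ) 1)
    (h0 : ∫ θ in Ioo 0 (π / 2), weighted 0 (fun q θ => (κ + 2 * q ^ 2 * cos θ ^ 2) * kerK q θ) a q θ
      = 0) :
    0 < ∫ θ in Ioo 0 (π / 2),
      weighted 0 (fun q θ => (κ + 2 * q ^ 2 * cos θ ^ 2) * kerK q θ) b q θ := by
  have hq' := Ioo_zero_one_subset hq
  have hq0 := hq.1
  set k : ℝ → ℝ → ℝ := fun q θ => (κ + 2 * q ^ 2 * cos θ ^ 2) * kerK q θ with hkdef
  have hk : ContinuousOn (Function.uncurry k) (Ioo (-1) 1 ×ˢ univ) :=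
    ContinuousOn.mul (f := fun x : ℝ × ℝ => κ + 2 * x.1 ^ 2 * cos x.2 ^ 2) (by fun_prop)
      continuousOn_kerK
  have hia := integrableOn_weighted 0 hk ha hq'
  have hib := integrableOn_weighted 0 hk (ha.trans hab) hq'
  have hker : ∀ θ, 0 < kerK q θ := fun θ => one_div_pos.2 (modular_pos hq' θ)
  have hκ : κ < 0 := by
    by_contra! hκ
    refine h0.not_gt (setIntegral_pos_of_pos hia fun θ hθ => ?_)
    have := cos_pos_of_mem_quarter hθ
    have := hker θ
    rw [weighted_zero]
    positivity
  -- The value of cos θ at which κ + 2q² cos²θ changes sign.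
  set c₀ := √(-κ / (2 * q ^ 2)) with hc₀
  have hc₀pos : 0 < c₀ := sqrt_pos.2 (div_pos (by linarith) (by positivity))
  have hc₀sq : κ = -(2 * q ^ 2 * c₀ ^ 2) := by
    rw [hc₀, sq_sqrt (div_pos (by linarith) (by positivity)).le]; field_simp
  have hb0 : -1 < b := ha.trans hab
  -- Subtracting a multiple of the vanishing integral turns the integrand into a product of two
  -- factors that both change sign at cos θ = c₀.
  have hdiff : ∫ θ in Ioo 0 (π / 2), weighted 0 k b q θ
      = ∫ θ in Ioo 0 (π / 2), (weighted 0 k b q θ - c₀ ^ (b - a) * weighted 0 k a q θ) := by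
    rw [integral_sub hib (hia.const_mul _), integral_const_mul, h0]; simp
  have hform : ∀ θ ∈ Ioo 0 (π / 2), weighted 0 k b q θ - c₀ ^ (b - a) * weighted 0 k a q θ =
      2 * q ^ 2 * kerK q θ * cos θ ^ a * ((cos θ ^ 2 - c₀ ^ 2) *
        (cos θ ^ (b - a) - c₀ ^ (b - a))) := fun θ hθ => by
    have hc := cos_pos_of_mem_quarter hθ
    have : cos θ ^ b = cos θ ^ a * cos θ ^ (b - a) := by rw [← rpow_add hc]; ring_nf
    simp only [weighted_zero, this, hkdef]
    rw [hc₀sq]; ring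
  have hsign : ∀ c, 0 < c → c ≠ c₀ → 0 < (c ^ 2 - c₀ ^ 2) * (c ^ (b - a) - c₀ ^ (b - a)) := by
    intro c hc hne
    rcases lt_or_gt_of_ne hne with h | h
    · refine mul_pos_of_neg_of_neg (by nlinarith) ?_
      linarith [rpow_lt_rpow hc.le h (sub_pos.2 hab)]
    · refine mul_pos (by nlinarith) ?_
      linarith [rpow_lt_rpow hc₀pos.le h (sub_pos.2 hab)]
  have hint : IntegrableOn (fun θ => weighted 0 k b q θ - c₀ ^ (b - a) * weighted 0 k a q θ)
      (Ioo 0 (π / 2)) := hib.sub (hia.const_mul _)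
  rw [hdiff, setIntegral_pos_iff_support_of_nonneg_ae _ hint]
  -- The integrand is positive off the single point where cos θ = c₀, a null set.
  · have hsub : Ioo 0 (π / 2) \ {arccos c₀} ⊆ Function.support
        (fun θ => weighted 0 k b q θ - c₀ ^ (b - a) * weighted 0 k a q θ) ∩ Ioo 0 (π / 2) := by
      refine fun θ hθ => ⟨?_, hθ.1⟩
      have hc := cos_pos_of_mem_quarter hθ.1
      rw [Function.mem_support, hform θ hθ.1]
      have hne : cos θ ≠ c₀ := fun h => hθ.2 (by
        rw [mem_singleton_iff, ← h, arccos_cos hθ.1.1.le (by linarith [hθ.1.2, pi_pos])])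
      have := hsign _ hc hne
      have := hker θ
      positivity
    refine lt_of_lt_of_le ?_ (measure_mono hsub)
    rw [measure_sdiff_null (by simp)]
    simp [pi_pos]
  · refine (ae_restrict_mem measurableSet_Ioo).mono fun θ hθ => ?_
    have hc := cos_pos_of_mem_quarter hθ
    have := hker θ
    simp only [Pi.zero_apply]
    rw [hform θ hθ]
    refine mul_nonneg (by positivity) ?_
    rcases eq_or_ne (cos θ) c₀ with h | h
    · simp [h]
    · exact (hsign _ hc h).le

lemma strictMonoOn_intFig_div_intK {q : ℝ} (hq : q ∈ Ioo (0 : ℝ) 1) :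
    StrictMonoOn (fun a => intFig a q / intK a q) (Ioi (-1)) := by
  intro a ha b hb hab
  have hq' := Ioo_zero_one_subset hq
  have hKa := intK_pos ha hq'
  have hKb := intK_pos hb hq'
  simp only []
  -- Subtracting the quotient at `a` gives a combination of 1 and cos² with mean zero for that
  -- exponent, as the Chebyshev argument requires.
  set m := intFig a q / intK a q with hm
  have key : ∀ c, -1 < c → ∫ θ in Ioo 0 (π / 2),
      weighted 0 (fun q' θ => (1 - m - 2 * q ^ 2 + 2 * q' ^ 2 * cos θ ^ 2) * kerK q' θ) c q θ =
        intFig c q - m * intK c q := fun c hc => by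
    rw [intFig, intK, ← integral_const_mul, ← integral_sub
      (integrableOn_weighted 0 continuousOn_kerFig hc hq')
      ((integrableOn_weighted 0 continuousOn_kerK hc hq').const_mul m)]
    refine integral_congr_ae (ae_of_all _ fun θ => ?_)
    simp only [weighted_zero, kerFig_eq hq']
    ring
  have h := integral_pos_of_exponent_lt ha hab hq (κ := 1 - m - 2 * q ^ 2)
    (by rw [key a ha, hm]; field_simp; ring)
  rw [key b hb] at h
  rw [lt_div_iff₀ hKb]
  linarith

lemma strictMonoOn_exponent : StrictMonoOn (fun p : ℝ => 1 - 2 / p) (Ioi 1) := by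
  intro p hp p' hp' h
  have : (0 : ℝ) < p := zero_lt_one.trans hp
  have : 2 / p' < 2 / p := div_lt_div_of_pos_left two_pos this h
  simp only []
  linarith

lemma strictMonoOn_Q {q : ℝ} (hq : q ∈ Ioo (0 : ℝ) 1) :
    StrictMonoOn (fun p : ℝ => Q p q) (Ioi 1) := by
  intro p hp p' hp' h
  simp only [Q_eq hp (Ioo_zero_one_subset hq), Q_eq hp' (Ioo_zero_one_subset hq)]
  exact strictMonoOn_intFig_div_intK hq (exponent_mem hp).1 (exponent_mem hp').1
    (strictMonoOn_exponent hp hp' h)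

/-! ### Existence and uniqueness of the root -/

lemma intFig_pos_of_two_mul_sq_le {a q : ℝ} (ha : -1 < a) (hq : q ∈ Ioo (-1 : ℝ) 1)
    (h : 2 * q ^ 2 ≤ 1) : 0 < intFig a q := by
  refine setIntegral_pos_of_pos (integrableOn_weighted 0 continuousOn_kerFig ha hq) fun θ hθ => ?_
  have hc := cos_pos_of_mem_quarter hθ
  have hD := modular_pos hq θ
  have hpos : 0 < 1 - 2 * q ^ 2 + 2 * q ^ 2 * cos θ ^ 2 := by
    rcases eq_or_ne q 0 with rfl | h0
    · norm_num
    · have : 0 < 2 * q ^ 2 * cos θ ^ 2 := by positivity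
      linarith
  rw [weighted_zero, kerFig_eq hq, kerK]
  positivity

lemma hasDerivAt_sin_mul_cos_rpow {a θ : ℝ} (h : 0 < cos θ) :
    HasDerivAt (fun θ => sin θ * cos θ ^ a)
      ((a + 1) * cos θ ^ (a + 1) - a * cos θ ^ (a - 1)) θ := by
  have := (hasDerivAt_sin θ).mul ((hasDerivAt_cos θ).rpow_const (p := a) (Or.inl h.ne'))
  convert! this using 1
  have h1 : cos θ ^ (a + 1) = cos θ ^ (a - 1) * cos θ ^ 2 := by
    rw [← rpow_natCast, ← rpow_add h]; norm_num; ring_nf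
  have h2 : cos θ ^ a = cos θ ^ (a - 1) * cos θ := by
    rw [← rpow_add_one h.ne']; ring_nf
  rw [h1, h2]
  linear_combination (a * cos θ ^ (a - 1)) * sin_sq_add_cos_sq θ

/-- Integrate the derivative of sin θ cos^a θ; both boundary values vanish because `a > 0`. -/
lemma wallis_rpow {a : ℝ} (ha : 0 < a) :
    (a + 1) * ∫ θ in Ioo 0 (π / 2), cos θ ^ (a + 1) = a * ∫ θ in Ioo 0 (π / 2), cos θ ^ (a - 1) := by
  have hi1 := (integrableOn_cos_rpow (a := a + 1) (by linarith)).const_mul (a + 1)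
  have hi2 := (integrableOn_cos_rpow (a := a - 1) (by linarith)).const_mul a
  have h := intervalIntegral.integral_eq_sub_of_hasDerivAt_of_le (a := 0) (b := π / 2)
    (f := fun θ => sin θ * cos θ ^ a) (by positivity)
    (continuous_sin.mul (continuous_cos.rpow_const fun _ => Or.inr ha.le)).continuousOn
    (fun θ hθ => hasDerivAt_sin_mul_cos_rpow (a := a) (cos_pos_of_mem_quarter hθ))
    ((intervalIntegrable_iff_integrableOn_Ioo_of_le (by positivity)).2 (hi1.sub hi2))
  rw [intervalIntegral.integral_of_le (by positivity), integral_Ioc_eq_integral_Ioo,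
    integral_sub hi1 hi2, integral_const_mul, integral_const_mul] at h
  simp [zero_rpow ha.ne'] at h
  linarith

lemma modular_one {θ : ℝ} (hθ : θ ∈ Ioo 0 (π / 2)) : modular 1 θ = cos θ := by
  rw [modular, one_pow, one_mul, ← cos_sq', sqrt_sq (cos_pos_of_mem_quarter hθ).le]

lemma cos_le_modular {q θ : ℝ} (hq : q ∈ Ioo (-1 : ℝ) 1) : cos θ ≤ modular q θ := by
  refine le_sqrt_of_sq_le ?_
  have h1 : q ^ 2 < 1 := by nlinarith [hq.1, hq.2]
  nlinarith [sin_sq_add_cos_sq θ, sq_nonneg (sin θ)]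

lemma tendsto_intFig_one {a : ℝ} (ha : 0 < a) :
    Tendsto (intFig a) (𝓝[<] 1)
      (𝓝 (2 * (∫ θ in Ioo 0 (π / 2), cos θ ^ (a + 1)) - ∫ θ in Ioo 0 (π / 2), cos θ ^ (a - 1))) := by
  have hi1 := (integrableOn_cos_rpow (a := a + 1) (by linarith)).const_mul 2
  have hi2 := integrableOn_cos_rpow (a := a - 1) (by linarith)
  have hi0 := integrableOn_cos_rpow (a := a) (by linarith)
  have hmem : ∀ᶠ q in 𝓝[<] (1 : ℝ), q ∈ Ioo (-1 : ℝ) 1 := Ioo_mem_nhdsLT (by norm_num)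
  rw [← integral_const_mul, ← integral_sub hi1 hi2]
  -- The majorant comes from Δ ≤ 1 and 1/Δ ≤ 1/cos θ; it is integrable because `a > 0`.
  refine tendsto_integral_filter_of_dominated_convergence
    (fun θ => 2 * cos θ ^ a + cos θ ^ (a - 1)) ?_ ?_ ((hi0.const_mul 2).add hi2) ?_
  · exact hmem.mono fun q hq => aestronglyMeasurable_weighted 0 continuousOn_kerFig a hq
  · refine hmem.mono fun q hq => (ae_restrict_mem measurableSet_Ioo).mono fun θ hθ => ?_
    have hc := cos_pos_of_mem_quarter hθ
    have hp := rpow_pos_of_pos hc a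
    have hD := modular_pos hq θ
    have hinv : 1 / modular q θ ≤ 1 / cos θ := one_div_le_one_div_of_le hc (cos_le_modular hq)
    rw [weighted_zero, norm_mul, norm_of_nonneg hp.le, norm_eq_abs, rpow_sub_one hc.ne']
    have : |kerFig q θ| ≤ 2 + 1 / cos θ := by
      have := modular_le_one q θ
      have : 0 < 1 / modular q θ := by positivity
      rw [kerFig, abs_le]
      constructor <;> linarith
    calc _ ≤ cos θ ^ a * (2 + 1 / cos θ) := by gcongr
      _ = _ := by ring
  · refine (ae_restrict_mem measurableSet_Ioo).mono fun θ hθ => ?_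
    have hc := cos_pos_of_mem_quarter hθ
    have hD : Tendsto (modular · θ) (𝓝[<] 1) (𝓝 (cos θ)) := by
      rw [← modular_one hθ]
      exact (Continuous.tendsto (by unfold modular; fun_prop) 1).mono_left nhdsWithin_le_nhds
    have := ((hD.const_mul 2).sub ((tendsto_const_nhds (x := (1 : ℝ))).div hD hc.ne')).const_mul (cos θ ^ a)
    simp only [weighted_zero]
    convert! this using 2
    rw [rpow_add_one hc.ne', rpow_sub_one hc.ne']
    ring

/-- For `a ≤ 0` the limit as `q` tends to 1 is not available, so a larger exponent `b ∈ (0,1)` is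
used; since the quotient increases with the exponent, negativity at `b` implies it at `a`. -/
lemma exists_intFig_neg {a : ℝ} (ha : a ∈ Ioo (-1 : ℝ) 1) : ∃ q ∈ Ioo (0 : ℝ) 1, intFig a q < 0 := by
  obtain ⟨b, hb, hb1⟩ := exists_between (max_lt ha.2 one_pos)
  have hb0 : 0 < b := (le_max_right _ _).trans_lt hb
  have hab : a < b := (le_max_left _ _).trans_lt hb
  have hw := wallis_rpow hb0
  have hpos : 0 < ∫ θ in Ioo 0 (π / 2), cos θ ^ (b + 1) :=
    setIntegral_pos_of_pos (integrableOn_cos_rpow (by linarith))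
      fun θ hθ => rpow_pos_of_pos (cos_pos_of_mem_quarter hθ) _
  -- By Wallis, `b` times the left side is `b - 1` times the integral of cos^(b+1).
  have hlt : 2 * (∫ θ in Ioo 0 (π / 2), cos θ ^ (b + 1)) -
      ∫ θ in Ioo 0 (π / 2), cos θ ^ (b - 1) < 0 := by
    nlinarith
  have hmem : ∀ᶠ q in 𝓝[<] (1 : ℝ), q ∈ Ioo (0 : ℝ) 1 := Ioo_mem_nhdsLT (by norm_num)
  obtain ⟨q, hqb, hq⟩ := (((tendsto_intFig_one hb0).eventually (gt_mem_nhds hlt)).and hmem).exists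
  refine ⟨q, hq, ?_⟩
  have hq' := Ioo_zero_one_subset hq
  have hb' : -1 < b := by linarith
  have h1 := strictMonoOn_intFig_div_intK hq ha.1 hb' hab
  have h2 := div_neg_of_neg_of_pos hqb (intK_pos hb' hq')
  by_contra! hn
  exact (h1.trans h2).not_ge (div_nonneg hn (intK_pos ha.1 hq').le)

lemma existsUnique_intFig_eq_zero {a : ℝ} (ha : a ∈ Ioo (-1 : ℝ) 1) :
    ∃! q, q ∈ Ioo (0 : ℝ) 1 ∧ intFig a q = 0 := by
  obtain ⟨q₁, hq₁, h₁⟩ := exists_intFig_neg ha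
  have h₀ : 0 < intFig a 0 := intFig_pos_of_two_mul_sq_le ha.1 (by norm_num) (by norm_num)
  have hcont : ContinuousOn (intFig a) (Icc 0 q₁) := fun q hq =>
    (hasDerivAt_intFig_modulus ha.1 ⟨by linarith [hq.1], by linarith [hq.2, hq₁.2]⟩
      ).continuousAt.continuousWithinAt
  obtain ⟨q, hq, h⟩ := intermediate_value_Ioo' hq₁.1.le hcont ⟨h₁, h₀⟩
  have hq01 : q ∈ Ioo (0 : ℝ) 1 := ⟨hq.1, hq.2.trans hq₁.2⟩
  exact ⟨q, ⟨hq01, h⟩, fun q' hq' =>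
    (strictAntiOn_intFig ha.1).injOn hq'.1 hq01 (hq'.2.trans h.symm)⟩

lemma Q_eq_zero_iff {p q : ℝ} (hp : 1 < p) (hq : q ∈ Ioo (0 : ℝ) 1) :
    Q p q = 0 ↔ intFig (1 - 2 / p) q = 0 := by
  have hq' := Ioo_zero_one_subset hq
  rw [Q_eq hp hq', div_eq_zero_iff, or_iff_left (intK_pos (exponent_mem hp).1 hq').ne']

lemma qStar_spec {p : ℝ} (hp : 1 < p) : qStar p ∈ Ioo (0 : ℝ) 1 ∧ Q p (qStar p) = 0 := by
  obtain ⟨q, ⟨hq, h⟩, -⟩ := existsUnique_intFig_eq_zero (exponent_mem hp)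
  have hex : ∃ q : ℝ, q ∈ Ioo (0 : ℝ) 1 ∧ Q p q = 0 := ⟨q, hq, (Q_eq_zero_iff hp hq).2 h⟩
  rw [qStar, dif_pos hex]
  exact hex.choose_spec

lemma intFig_qStar {p : ℝ} (hp : 1 < p) : intFig (1 - 2 / p) (qStar p) = 0 :=
  (Q_eq_zero_iff hp (qStar_spec hp).1).1 (qStar_spec hp).2

lemma eq_qStar_of_intFig {p q : ℝ} (hp : 1 < p) (hq : q ∈ Ioo (0 : ℝ) 1)
    (h : intFig (1 - 2 / p) q = 0) : q = qStar p :=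
  (existsUnique_intFig_eq_zero (exponent_mem hp)).unique ⟨hq, h⟩
    ⟨(qStar_spec hp).1, intFig_qStar hp⟩

lemma eq_qStar {p q : ℝ} (hp : 1 < p) (hq : q ∈ Ioo (0 : ℝ) 1) (h : Q p q = 0) : q = qStar p :=
  eq_qStar_of_intFig hp hq ((Q_eq_zero_iff hp hq).1 h)

/-- The sign of `intFig` tells on which side of the root `q` lies; with its counterpart below this
yields the monotonicity and the limits of `qStar`. -/
lemma lt_qStar_of_intFig_pos {p q : ℝ} (hp : 1 < p) (hq : q ∈ Ioo (0 : ℝ) 1)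
    (h : 0 < intFig (1 - 2 / p) q) : q < qStar p :=
  ((strictAntiOn_intFig (exponent_mem hp).1).lt_iff_gt (qStar_spec hp).1 hq).1
    (by rwa [intFig_qStar hp])

lemma qStar_lt_of_intFig_neg {p q : ℝ} (hp : 1 < p) (hq : q ∈ Ioo (0 : ℝ) 1)
    (h : intFig (1 - 2 / p) q < 0) : qStar p < q :=
  ((strictAntiOn_intFig (exponent_mem hp).1).lt_iff_gt hq (qStar_spec hp).1).1
    (by rwa [intFig_qStar hp])

lemma one_lt_two_mul_qStar_sq {p : ℝ} (hp : 1 < p) : 1 < 2 * qStar p ^ 2 := by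
  by_contra! h
  exact (intFig_pos_of_two_mul_sq_le (exponent_mem hp).1
    (Ioo_zero_one_subset (qStar_spec hp).1) h).ne' (intFig_qStar hp)

lemma strictMonoOn_qStar : StrictMonoOn qStar (Ioi 1) := by
  intro p hp p' hp' h
  have hq := (qStar_spec hp).1
  refine lt_qStar_of_intFig_pos hp' hq ?_
  -- At the root for `p`, the quotient for the larger `p'` is already positive.
  have h1 := strictMonoOn_Q hq hp hp' h
  simp only [(qStar_spec hp).2, Q_eq hp' (Ioo_zero_one_subset hq)] at h1
  exact (div_pos_iff_of_pos_right (intK_pos (exponent_mem hp').1 (Ioo_zero_one_subset hq))).1 h1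

lemma strictAntiOn_phiStar : StrictAntiOn phiStar (Ioi 1) := by
  intro p hp p' hp' h
  have h1 := (qStar_spec hp).1
  have h2 := (qStar_spec hp').1
  have := strictMonoOn_arcsin ⟨by linarith [h1.1], h1.2.le⟩ ⟨by linarith [h2.1], h2.2.le⟩
    (strictMonoOn_qStar hp hp' h)
  simp only [phiStar]
  linarith

/-! ### Limits of the root -/

lemma intFig_eq_intK {a q : ℝ} (ha : -1 < a) (hq : q ∈ Ioo (-1 : ℝ) 1) :
    intFig a q = (1 - 2 * q ^ 2) * intK a q + 2 * q ^ 2 * intK (a + 2) q := by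
  rw [intFig, intK, intK, ← integral_const_mul, ← integral_const_mul, ← integral_add
    ((integrableOn_weighted 0 continuousOn_kerK ha hq).const_mul _)
    ((integrableOn_weighted 0 continuousOn_kerK (by linarith) hq).const_mul _)]
  refine setIntegral_congr_fun measurableSet_Ioo fun θ hθ => ?_
  have hc := cos_pos_of_mem_quarter hθ
  simp only [weighted_zero, kerFig_eq hq, rpow_add hc, rpow_two]
  ring

/-- sin θ ≤ 1 ≤ 1/Δ, and cos^a sin integrates to 1/(a+1). This is the blow-up as `a` tends to `-1`.
-/
lemma one_div_le_intK {a q : ℝ} (ha : -1 < a) (hq : q ∈ Ioo (-1 : ℝ) 1) :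
    1 / (a + 1) ≤ intK a q := by
  rw [← setIntegral_cos_rpow_mul_sin ha]
  refine setIntegral_mono_on ((integrableOn_cos_rpow_mul_sin ha).mono_set Ioo_subset_Ioc_self)
    (integrableOn_weighted 0 continuousOn_kerK ha hq) measurableSet_Ioo fun θ hθ => ?_
  rw [weighted_zero]
  have := rpow_pos_of_pos (cos_pos_of_mem_quarter hθ) a
  gcongr
  exact (sin_le_one θ).trans (one_le_one_div (modular_pos hq θ) (modular_le_one q θ))

lemma antitoneOn_intK {q : ℝ} (hq : q ∈ Ioo (-1 : ℝ) 1) :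
    AntitoneOn (intK · q) (Ioi (-1)) := by
  intro a ha b hb hab
  refine setIntegral_mono_on (integrableOn_weighted 0 continuousOn_kerK hb hq)
    (integrableOn_weighted 0 continuousOn_kerK ha hq) measurableSet_Ioo fun θ hθ => ?_
  rw [weighted_zero, weighted_zero]
  have : 0 < kerK q θ := one_div_pos.2 (modular_pos hq θ)
  gcongr ?_ * _
  exact rpow_le_rpow_of_exponent_ge (cos_pos_of_mem_quarter hθ) (cos_le_one θ) hab

/-- In `intFig_eq_intK` the negative term is at most -(2q² - 1)/(a + 1), while the positive one
stays bounded because `a + 2 > 0`. -/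
lemma intFig_neg_of_small {a q : ℝ} (ha : -1 < a) (hq : q ∈ Ioo (-1 : ℝ) 1) (hq2 : 1 < 2 * q ^ 2)
    (h : (a + 1) * (2 * q ^ 2 * intK 0 q) < 2 * q ^ 2 - 1) : intFig a q < 0 := by
  have h1 := one_div_le_intK ha hq
  have h2 : intK (a + 2) q ≤ intK 0 q :=
    antitoneOn_intK hq (by norm_num) (by simp; linarith) (by linarith)
  have ha1 : 0 < a + 1 := by linarith
  have h3 : 2 * q ^ 2 * intK 0 q < (2 * q ^ 2 - 1) * (1 / (a + 1)) := by
    rw [mul_one_div, lt_div_iff₀ ha1]; linarith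
  rw [intFig_eq_intK ha hq]
  have h4 : (2 * q ^ 2 - 1) * (1 / (a + 1)) ≤ (2 * q ^ 2 - 1) * intK a q := by
    gcongr
  have h5 : 2 * q ^ 2 * intK (a + 2) q ≤ 2 * q ^ 2 * intK 0 q := by gcongr
  linarith

lemma sqrt_two_div_two_lt_qStar {p : ℝ} (hp : 1 < p) : √2 / 2 < qStar p := by
  have h1 := one_lt_two_mul_qStar_sq hp
  refine lt_of_pow_lt_pow_left₀ 2 (qStar_spec hp).1.1.le ?_
  rw [div_pow, sq_sqrt zero_le_two]
  linarith

lemma tendsto_qStar_one : Tendsto qStar (𝓝[>] 1) (𝓝 (√2 / 2)) := by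
  rw [tendsto_order]
  refine ⟨fun r hr => ?_, fun r hr => ?_⟩
  · filter_upwards [self_mem_nhdsWithin] with p hp
    exact hr.trans (sqrt_two_div_two_lt_qStar hp)
  · have hs : √2 / 2 < 1 := by
      rw [div_lt_one two_pos, sqrt_lt' two_pos]; norm_num
    have hs0 : 0 < √2 / 2 := by positivity
    obtain ⟨q, hq1, hq2⟩ := exists_between (lt_min hr hs)
    have hq : q ∈ Ioo (0 : ℝ) 1 := ⟨hs0.trans hq1, hq2.trans_le (min_le_right _ _)⟩
    have hsq : 1 < 2 * q ^ 2 := by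
      have := pow_lt_pow_left₀ hq1 hs0.le two_ne_zero
      rw [div_pow, sq_sqrt zero_le_two] at this
      linarith
    have ht : Tendsto (fun p : ℝ => (1 - 2 / p + 1) * (2 * q ^ 2 * intK 0 q)) (𝓝[>] 1) (𝓝 0) := by
      have hc : ContinuousAt (fun p : ℝ => (1 - 2 / p + 1) * (2 * q ^ 2 * intK 0 q)) 1 :=
        ((continuousAt_const.sub (continuousAt_const.div continuousAt_id one_ne_zero)).add
          continuousAt_const).mul continuousAt_const
      have := hc.tendsto.mono_left (nhdsWithin_le_nhds (s := Ioi 1))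
      convert! this using 2
      norm_num
    filter_upwards [self_mem_nhdsWithin, ht.eventually (gt_mem_nhds (sub_pos.2 hsq))] with p hp h
    exact (qStar_lt_of_intFig_neg hp hq (intFig_neg_of_small (exponent_mem hp).1
      (Ioo_zero_one_subset hq) hsq h)).trans (hq2.trans_le (min_le_left _ _))

lemma tendsto_phiStar_one : Tendsto phiStar (𝓝[>] 1) (𝓝 (π / 2)) := by
  have h := ((continuous_arcsin.tendsto _).comp tendsto_qStar_one).const_mul 2 |>.const_sub π
  convert! h using 2
  rw [arcsin_eq_of_sin_eq sin_pi_div_four ⟨by linarith [pi_pos], by linarith [pi_pos]⟩]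
  ring

lemma hasDerivAt_modular_angle {q : ℝ} (hq : q ∈ Ioo (-1 : ℝ) 1) (θ : ℝ) :
    HasDerivAt (modular q) (-(q ^ 2 * sin θ * cos θ) / modular q θ) θ := by
  have h := ((((hasDerivAt_sin θ).pow 2).const_mul (q ^ 2)).const_sub 1).sqrt
    (one_sub_sq_mul_sin_sq_pos hq θ).ne'
  convert! h using 1
  simp only [modular, Pi.pow_apply]
  field_simp
  norm_num
  ring

lemma continuous_modular_angle (q : ℝ) : Continuous (modular q) := by
  unfold modular; fun_prop

/-- At the limiting exponent the integrand has the antiderivative sin θ Δ. -/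
lemma intFig_exponent_one {q : ℝ} (hq : q ∈ Ioo (-1 : ℝ) 1) : intFig 1 q = √(1 - q ^ 2) := by
  have hi := integrableOn_weighted 0 continuousOn_kerFig (a := 1) (by norm_num) hq
  have h := intervalIntegral.integral_eq_sub_of_hasDerivAt_of_le (a := 0) (b := π / 2)
    (f := fun θ => sin θ * modular q θ) (f' := weighted 0 kerFig 1 q) (by positivity)
    (continuous_sin.mul (continuous_modular_angle q)).continuousOn
    (fun θ hθ => by
      convert! (hasDerivAt_sin θ).mul (hasDerivAt_modular_angle hq θ) using 1
      have hD := (modular_pos hq θ).ne'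
      simp only [weighted_zero, rpow_one, kerFig]
      field_simp
      rw [modular_sq hq]
      ring)
    ((intervalIntegrable_iff_integrableOn_Ioo_of_le (by positivity)).2 hi)
  rw [intervalIntegral.integral_of_le (by positivity), integral_Ioc_eq_integral_Ioo] at h
  rw [intFig, h]
  simp [modular]

lemma tendsto_qStar_atTop : Tendsto qStar atTop (𝓝 1) := by
  rw [tendsto_order]
  refine ⟨fun r hr => ?_, fun r hr => ?_⟩
  · obtain ⟨q, hq1, hq2⟩ := exists_between (max_lt hr zero_lt_one)
    have hq : q ∈ Ioo (0 : ℝ) 1 := ⟨(le_max_right _ _).trans_lt hq1, hq2⟩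
    have hq' := Ioo_zero_one_subset hq
    have hpos : 0 < intFig 1 q := by
      rw [intFig_exponent_one hq']
      exact sqrt_pos.2 (by nlinarith [hq.1, hq.2])
    have ht : Tendsto (fun p : ℝ => 1 - 2 / p) atTop (𝓝 1) := by
      simpa using (tendsto_id.const_div_atTop (2 : ℝ)).const_sub 1
    have hc := (hasDerivAt_intFig_exponent (a := 1) (by norm_num) hq').continuousAt.tendsto.comp ht
    filter_upwards [eventually_gt_atTop 1, hc.eventually (lt_mem_nhds hpos)] with p hp h
    exact ((le_max_left _ _).trans_lt hq1).trans (lt_qStar_of_intFig_pos hp hq h)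
  · filter_upwards [eventually_gt_atTop 1] with p hp
    exact (qStar_spec hp).1.2.trans hr

lemma tendsto_phiStar_atTop : Tendsto phiStar atTop (𝓝 0) := by
  have h := ((continuous_arcsin.tendsto _).comp tendsto_qStar_atTop).const_mul 2 |>.const_sub π
  convert! h using 2
  rw [arcsin_one]
  ring

/-! ### Differentiability of the root -/

lemma continuousAt_intFigExponent {a q : ℝ} (ha : -1 < a) (hq : q ∈ Ioo (-1 : ℝ) 1) :
    ContinuousAt (fun v : ℝ × ℝ => intFigExponent v.1 v.2) (a, q) :=
  continuousAt_integral_weighted 1 continuousOn_kerFig ha hq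

lemma continuousAt_intFigModulus {a q : ℝ} (ha : -1 < a) (hq : q ∈ Ioo (-1 : ℝ) 1) :
    ContinuousAt (fun v : ℝ × ℝ => intFigModulus v.1 v.2) (a, q) :=
  continuousAt_integral_weighted 0 continuousOn_kerFig' ha hq

lemma hasDerivAt_exponent {p : ℝ} (hp : p ≠ 0) :
    HasDerivAt (fun p : ℝ => 1 - 2 / p) (2 / p ^ 2) p := by
  have h := ((hasDerivAt_inv hp).const_mul 2).const_sub 1
  convert! h using 1
  field_simp

lemma hasDerivAt_qStar {p : ℝ} (hp : 1 < p) :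
    HasDerivAt qStar (-(intFigExponent (1 - 2 / p) (qStar p) /
      intFigModulus (1 - 2 / p) (qStar p)) * (2 / p ^ 2)) p := by
  set a := 1 - 2 / p with ha_def
  set q := qStar p with hq_def
  have ha : -1 < a := (exponent_mem hp).1
  have hq : q ∈ Ioo (0 : ℝ) 1 := (qStar_spec hp).1
  have hq' := Ioo_zero_one_subset hq
  have hnhds : ∀ᶠ v : ℝ × ℝ in 𝓝 (a, q), v ∈ Ioi (-1 : ℝ) ×ˢ Ioo (-1 : ℝ) 1 :=
    prod_mem_nhds (Ioi_mem_nhds ha) (Ioo_mem_nhds hq'.1 hq'.2)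
  have df₁ : ∀ᶠ v : ℝ × ℝ in 𝓝 (a, q), HasFDerivAt (intFig · v.2)
      (ContinuousLinearMap.toSpanSingleton ℝ (intFigExponent v.1 v.2)) v.1 :=
    hnhds.mono fun v hv => (hasDerivAt_intFig_exponent hv.1 hv.2).hasFDerivAt
  have df₂ : ∀ᶠ v : ℝ × ℝ in 𝓝 (a, q), HasFDerivAt (intFig v.1 ·)
      (ContinuousLinearMap.toSpanSingleton ℝ (intFigModulus v.1 v.2)) v.2 :=
    hnhds.mono fun v hv => (hasDerivAt_intFig_modulus hv.1 hv.2).hasFDerivAt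
  have cf₁ : ContinuousAt (fun v : ℝ × ℝ =>
      ContinuousLinearMap.toSpanSingleton ℝ (intFigExponent v.1 v.2)) (a, q) :=
    (ContinuousLinearMap.toSpanSingletonCLE (𝕜 := ℝ) (E := ℝ)).continuous.continuousAt.comp
      (continuousAt_intFigExponent ha hq')
  have cf₂ : ContinuousAt (fun v : ℝ × ℝ =>
      ContinuousLinearMap.toSpanSingleton ℝ (intFigModulus v.1 v.2)) (a, q) :=
    (ContinuousLinearMap.toSpanSingletonCLE (𝕜 := ℝ) (E := ℝ)).continuous.continuousAt.comp
      (continuousAt_intFigModulus ha hq')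
  have hne := (intFigModulus_neg ha hq).ne
  set e := ContinuousLinearEquiv.unitsEquivAut ℝ (Units.mk0 _ hne) with he
  have hee : (e : ℝ →L[ℝ] ℝ) = ContinuousLinearMap.toSpanSingleton ℝ (intFigModulus a q) := by
    ext; simp [he]
  have hinv : (ContinuousLinearMap.toSpanSingleton ℝ (intFigModulus a q)).IsInvertible := ⟨e, hee⟩
  have hψ := hasStrictFDerivAt_implicitFunctionOfBivariate
    (f₁ := fun a q => ContinuousLinearMap.toSpanSingleton ℝ (intFigExponent a q))
    (f₂ := fun a q => ContinuousLinearMap.toSpanSingleton ℝ (intFigModulus a q))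
    df₁ df₂ cf₁ cf₂ hinv
  have ht := tendsto_implicitFunctionOfBivariate
    (f₁ := fun a q => ContinuousLinearMap.toSpanSingleton ℝ (intFigExponent a q))
    (f₂ := fun a q => ContinuousLinearMap.toSpanSingleton ℝ (intFigModulus a q))
    df₁ df₂ cf₁ cf₂ hinv
  have hz := eventually_apply_implicitFunctionOfBivariate
    (f₁ := fun a q => ContinuousLinearMap.toSpanSingleton ℝ (intFigExponent a q))
    (f₂ := fun a q => ContinuousLinearMap.toSpanSingleton ℝ (intFigModulus a q))
    df₁ df₂ cf₁ cf₂ hinv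
  set ψ := implicitFunctionOfBivariate
    (f₁ := fun a q => ContinuousLinearMap.toSpanSingleton ℝ (intFigExponent a q))
    (f₂ := fun a q => ContinuousLinearMap.toSpanSingleton ℝ (intFigModulus a q))
    df₁ df₂ cf₁ cf₂ hinv
  have hexp := hasDerivAt_exponent (p := p) (by linarith)
  have hcexp : Tendsto (fun p : ℝ => 1 - 2 / p) (𝓝 p) (𝓝 a) := hexp.continuousAt
  -- Uniqueness of the root identifies `qStar` with the implicit function once the latter lies in
  -- `(0,1)`; no prior continuity of `qStar` is needed.
  have heq : qStar =ᶠ[𝓝 p] fun p => ψ (1 - 2 / p) := by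
    filter_upwards [Ioi_mem_nhds hp, hcexp.eventually (ht.eventually (Ioo_mem_nhds hq.1 hq.2)),
      hcexp.eventually hz] with p' hp' h1 h2
    exact (eq_qStar_of_intFig hp' h1 (h2.trans (intFig_qStar hp))).symm
  have hψ' : HasDerivAt ψ (-(intFigExponent a q / intFigModulus a q)) a := by
    convert! hψ.hasFDerivAt.hasDerivAt using 1
    simp only [← hee, ContinuousLinearMap.inverse_equiv]
    simp [he, div_eq_mul_inv]
  exact (hψ'.comp p hexp).congr_of_eventuallyEq heq

lemma contDiffOn_qStar : ContDiffOn ℝ 1 qStar (Ioi 1) := by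
  have hdiff : DifferentiableOn ℝ qStar (Ioi 1) := fun p hp =>
    (hasDerivAt_qStar hp).differentiableAt.differentiableWithinAt
  rw [show (1 : WithTop ℕ∞) = 0 + 1 from rfl, contDiffOn_succ_iff_deriv_of_isOpen isOpen_Ioi]
  refine ⟨hdiff, by simp, contDiffOn_zero.2 ?_⟩
  refine ContinuousOn.congr ?_ fun p hp => (hasDerivAt_qStar hp).deriv
  intro p hp
  have hq := (qStar_spec hp).1
  have hp0 : p ≠ 0 := (zero_lt_one.trans hp).ne'
  have ha := (exponent_mem hp).1
  have hpair : ContinuousAt (fun p => (1 - 2 / p, qStar p)) p :=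
    (hasDerivAt_exponent hp0).continuousAt.prodMk (hasDerivAt_qStar hp).continuousAt
  have h1 := ContinuousAt.comp (f := fun p => (1 - 2 / p, qStar p))
    (continuousAt_intFigExponent ha (Ioo_zero_one_subset hq)) hpair
  have h2 := ContinuousAt.comp (f := fun p => (1 - 2 / p, qStar p))
    (continuousAt_intFigModulus ha (Ioo_zero_one_subset hq)) hpair
  exact ((h1.div h2 (intFigModulus_neg ha hq).ne).neg.mul (continuousAt_const.div
    (continuousAt_id.pow 2) (pow_ne_zero 2 hp0))).continuousWithinAt

lemma contDiffOn_phiStar : ContDiffOn ℝ 1 phiStar (Ioi 1) := fun p hp =>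
  contDiffWithinAt_const.sub (contDiffWithinAt_const.mul
    ((contDiffAt_arcsin (by linarith [(qStar_spec hp).1.1]) (qStar_spec hp).1.2.ne
      ).comp_contDiffWithinAt p (contDiffOn_qStar p hp)))

/-! ### The incomplete integrals and the amplitude -/

lemma intervalIntegrable_abs_cos_rpow {a : ℝ} (ha : -1 < a) (x y : ℝ) :
    IntervalIntegrable (fun θ => |cos θ| ^ a) volume x y := by
  have h1 : IntervalIntegrable (fun θ => |cos θ| ^ a) volume 0 (π / 2) := by
    rw [intervalIntegrable_iff_integrableOn_Ioo_of_le (by positivity)]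
    exact (integrableOn_cos_rpow ha).congr_fun
      (fun θ hθ => by simp only [abs_of_pos (cos_pos_of_mem_quarter hθ)]) measurableSet_Ioo
  have h2 : IntervalIntegrable (fun θ => |cos θ| ^ a) volume (-(π / 2)) 0 := by
    have := (h1.comp_mul_left (c := -1)).symm
    simpa [div_neg] using this
  refine Function.Periodic.intervalIntegrable (T := π) (t := -(π / 2)) (fun θ => ?_) pi_ne_zero ?_ x y
  · simp only [cos_add_pi, abs_neg]
  · rw [show -(π / 2) + π = π / 2 by ring]
    exact h2.trans h1

lemma intervalIntegrable_F {p q : ℝ} (hp : 1 < p) (hq : q ∈ Ioo (-1 : ℝ) 1) (x y : ℝ) :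
    IntervalIntegrable (fun θ => |cos θ| ^ (1 - 2 / p) / modular q θ) volume x y :=
  (intervalIntegrable_abs_cos_rpow (exponent_mem hp).1 x y).mul_continuousOn
    ((continuous_modular_angle q).inv₀ fun θ => (modular_pos hq θ).ne').continuousOn

lemma intervalIntegrable_EInc {p : ℝ} (hp : 1 < p) (q x y : ℝ) :
    IntervalIntegrable (fun θ => modular q θ * |cos θ| ^ (1 - 2 / p)) volume x y :=
  (intervalIntegrable_abs_cos_rpow (exponent_mem hp).1 x y).continuousOn_mul
    (continuous_modular_angle q).continuousOn

lemma continuous_F {p q : ℝ} (hp : 1 < p) (hq : q ∈ Ioo (-1 : ℝ) 1) : Continuous (F p · q) :=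
  intervalIntegral.continuous_primitive (intervalIntegrable_F hp hq) 0

lemma continuous_EInc {p : ℝ} (hp : 1 < p) (q : ℝ) : Continuous (EInc p · q) :=
  intervalIntegral.continuous_primitive (intervalIntegrable_EInc hp q) 0

lemma volume_cos_eq_zero : volume {θ : ℝ | cos θ = 0} = 0 := by
  refine Set.Countable.measure_zero ?_ _
  have : {θ : ℝ | cos θ = 0} ⊆ range fun k : ℤ => (2 * k + 1) * π / 2 := fun θ hθ => by
    obtain ⟨k, hk⟩ := cos_eq_zero_iff.1 hθ
    exact ⟨k, hk.symm⟩
  exact (countable_range _).mono this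

/-- The integrand is positive except possibly at the countably many zeros of the cosine. -/
lemma strictMono_F {p q : ℝ} (hp : 1 < p) (hq : q ∈ Ioo (-1 : ℝ) 1) : StrictMono (F p · q) := by
  intro x y hxy
  have hnonneg : ∀ θ, 0 ≤ |cos θ| ^ (1 - 2 / p) / modular q θ := fun θ =>
    div_nonneg (rpow_nonneg (abs_nonneg _) _) (modular_pos hq θ).le
  have hpos : 0 < ∫ θ in x..y, |cos θ| ^ (1 - 2 / p) / modular q θ := by
    rw [intervalIntegral.integral_pos_iff_support_of_nonneg_ae (ae_of_all _ hnonneg)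
      (intervalIntegrable_F hp hq x y)]
    refine ⟨hxy, ?_⟩
    have hsub : Ioc x y \ {θ : ℝ | cos θ = 0} ⊆
        Function.support (fun θ => |cos θ| ^ (1 - 2 / p) / modular q θ) ∩ Ioc x y :=
      fun θ hθ => ⟨(div_pos (rpow_pos_of_pos (abs_pos.2 hθ.2) _) (modular_pos hq θ)).ne', hθ.1⟩
    refine lt_of_lt_of_le ?_ (measure_mono hsub)
    rw [measure_sdiff_null volume_cos_eq_zero]
    simpa using hxy
  have h := intervalIntegral.integral_interval_sub_left (intervalIntegrable_F hp hq 0 y)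
    (intervalIntegrable_F hp hq 0 x)
  simp only [F_eq]
  linarith

lemma primitive_neg {f : ℝ → ℝ} (hf : ∀ θ, f (-θ) = f θ) (x : ℝ) :
    ∫ θ in (0 : ℝ)..-x, f θ = -∫ θ in (0 : ℝ)..x, f θ := by
  have h := intervalIntegral.integral_comp_neg (a := 0) (b := x) f
  simp only [hf, neg_zero] at h
  rw [h, intervalIntegral.integral_symm]

lemma F_neg (p x q : ℝ) : F p (-x) q = -F p x q :=
  primitive_neg (fun θ => by simp) x

lemma EInc_neg (p x q : ℝ) : EInc p (-x) q = -EInc p x q :=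
  primitive_neg (fun θ => by simp) x

lemma am_F {p q : ℝ} (hp : 1 < p) (hq : q ∈ Ioo (-1 : ℝ) 1) (x : ℝ) : am p (F p x q) q = x :=
  Function.leftInverse_invFun (strictMono_F hp hq).injective x

/-- Surjectivity onto `[-K, K]` suffices: only this range of arc length enters the half-fold curve.
-/
lemma exists_F_eq {p q s : ℝ} (hp : 1 < p) (hq : q ∈ Ioo (-1 : ℝ) 1)
    (hs : s ∈ Icc (-K p q) (K p q)) : ∃ θ, F p θ q = s := by
  have h := intermediate_value_Icc (a := -(π / 2)) (b := π / 2) (by linarith [pi_pos])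
    (continuous_F hp hq).continuousOn
  rw [F_neg] at h
  obtain ⟨θ, -, hθ⟩ := h hs
  exact ⟨θ, hθ⟩

lemma am_neg {p q s : ℝ} (hp : 1 < p) (hq : q ∈ Ioo (-1 : ℝ) 1)
    (hs : s ∈ Icc (-K p q) (K p q)) : am p (-s) q = -am p s q := by
  obtain ⟨θ, rfl⟩ := exists_F_eq hp hq hs
  rw [← F_neg, am_F hp hq, am_F hp hq]

lemma am_K {p q : ℝ} (hp : 1 < p) (hq : q ∈ Ioo (-1 : ℝ) 1) : am p (K p q) q = π / 2 :=
  am_F hp hq _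

lemma F_am {p q s : ℝ} (hp : 1 < p) (hq : q ∈ Ioo (-1 : ℝ) 1)
    (hs : s ∈ Icc (-K p q) (K p q)) : F p (am p s q) q = s := by
  obtain ⟨θ, rfl⟩ := exists_F_eq hp hq hs
  rw [am_F hp hq]

lemma tendsto_am {p q : ℝ} (hp : 1 < p) (hq : q ∈ Ioo (-1 : ℝ) 1) :
    Tendsto (am p · q) (𝓝[<] K p q) (𝓝[<] (π / 2)) := by
  have hF := strictMono_F hp hq
  have hmem : ∀ᶠ s in 𝓝[<] K p q, s ∈ Ioo (-K p q) (K p q) :=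
    Ioo_mem_nhdsLT (by linarith [K_pos hp hq])
  have hlt : ∀ᶠ s in 𝓝[<] K p q, am p s q < π / 2 := hmem.mono fun s hs => by
    rw [← hF.lt_iff_lt, F_am hp hq (Ioo_subset_Icc_self hs)]
    exact hs.2
  refine tendsto_nhdsWithin_iff.2 ⟨tendsto_order.2 ⟨fun l hl => ?_, fun u hu => ?_⟩, hlt⟩
  · filter_upwards [hmem, Ioo_mem_nhdsLT (hF hl)] with s hs hs'
    rw [← hF.lt_iff_lt, F_am hp hq (Ioo_subset_Icc_self hs)]
    exact hs'.1
  · exact hlt.mono fun s hs => hs.trans hu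

lemma continuousAt_abs_cos_rpow (a : ℝ) {θ : ℝ} (hθ : θ ∈ Ioo 0 (π / 2)) :
    ContinuousAt (fun θ => |cos θ| ^ a) θ :=
  continuous_cos.abs.continuousAt.rpow_const (Or.inl (abs_pos.2 (cos_pos_of_mem_quarter hθ).ne').ne')

lemma stronglyMeasurable_abs_cos_rpow (a : ℝ) : StronglyMeasurable fun θ : ℝ => |cos θ| ^ a :=
  (measurable_cos.norm.pow_const a).stronglyMeasurable

lemma hasDerivAt_F {p q θ : ℝ} (hp : 1 < p) (hq : q ∈ Ioo (-1 : ℝ) 1) (hθ : θ ∈ Ioo 0 (π / 2)) :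
    HasDerivAt (F p · q) (|cos θ| ^ (1 - 2 / p) / modular q θ) θ :=
  intervalIntegral.integral_hasDerivAt_right (intervalIntegrable_F hp hq 0 θ)
    ((stronglyMeasurable_abs_cos_rpow _).div₀
      (continuous_modular_angle q).stronglyMeasurable
      fun θ => (modular_pos hq θ).ne').stronglyMeasurableAtFilter
    ((continuousAt_abs_cos_rpow _ hθ).div (continuous_modular_angle q).continuousAt
      (modular_pos hq θ).ne')

lemma hasDerivAt_EInc {p q θ : ℝ} (hp : 1 < p) (hθ : θ ∈ Ioo 0 (π / 2)) :
    HasDerivAt (EInc p · q) (modular q θ * |cos θ| ^ (1 - 2 / p)) θ :=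
  intervalIntegral.integral_hasDerivAt_right (intervalIntegrable_EInc hp q 0 θ)
    ((continuous_modular_angle q).stronglyMeasurable.mul
      (stronglyMeasurable_abs_cos_rpow _)).stronglyMeasurableAtFilter
    ((continuous_modular_angle q).continuousAt.mul (continuousAt_abs_cos_rpow _ hθ))

/-! ### Tangent vectors at the end points -/

/-- The difference quotient in `s` equals that of `X` against `F` at θ = am(s). L'Hôpital's rule
cancels the factor |cos θ|^(1 - 2/p)/Δ, which may vanish or blow up at π/2, and leaves `g`. -/
lemma hasDerivWithinAt_comp_am {p q : ℝ} (hp : 1 < p) (hq : q ∈ Ioo (-1 : ℝ) 1) {X : ℝ → ℝ}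
    {g : ℝ → ℝ} (hX : Continuous X) (hg : Continuous g)
    (hX' : ∀ θ ∈ Ioo 0 (π / 2),
      HasDerivAt X (g θ * (|cos θ| ^ (1 - 2 / p) / modular q θ)) θ) :
    HasDerivWithinAt (fun s => X (am p s q)) (g (π / 2)) (Iio (K p q)) (K p q) := by
  have hF' : ∀ θ ∈ Ioo 0 (π / 2), 0 < |cos θ| ^ (1 - 2 / p) / modular q θ := fun θ hθ =>
    div_pos (rpow_pos_of_pos (abs_pos.2 (cos_pos_of_mem_quarter hθ).ne') _) (modular_pos hq θ)
  have hlim : Tendsto (fun θ => (X θ - X (π / 2)) / (F p θ q - F p (π / 2) q)) (𝓝[<] (π / 2))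
      (𝓝 (g (π / 2))) := by
    refine HasDerivAt.lhopital_zero_left_on_Ioo (a := 0) (by positivity)
      (fun θ hθ => (hX' θ hθ).sub_const _) (fun θ hθ => (hasDerivAt_F hp hq hθ).sub_const _)
      (fun θ hθ => (hF' θ hθ).ne') ?_ ?_ ?_
    · have := ((hX.sub (continuous_const (y := X (π / 2)))).tendsto (π / 2)).mono_left
        (nhdsWithin_le_nhds (s := Iio (π / 2)))
      simpa [Pi.sub_def] using this
    · have := (((continuous_F hp hq).sub (continuous_const (y := F p (π / 2) q))).tendsto
        (π / 2)).mono_left (nhdsWithin_le_nhds (s := Iio (π / 2)))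
      simpa [Pi.sub_def] using this
    · refine ((hg.tendsto (π / 2)).mono_left nhdsWithin_le_nhds).congr' ?_
      filter_upwards [Ioo_mem_nhdsLT (show (0 : ℝ) < π / 2 by positivity)] with θ hθ
      rw [mul_div_cancel_right₀ _ (hF' θ hθ).ne']
  rw [hasDerivWithinAt_iff_tendsto_slope' self_notMem_Iio]
  refine (hlim.comp (tendsto_am hp hq)).congr' ?_
  filter_upwards [Ioo_mem_nhdsLT (show -K p q < K p q by linarith [K_pos hp hq])] with s hs
  rw [slope_def_field, am_K hp hq, Function.comp_apply, F_am hp hq (Ioo_subset_Icc_self hs), K]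

lemma hasDerivWithinAt_EInc_am {p q : ℝ} (hp : 1 < p) (hq : q ∈ Ioo (-1 : ℝ) 1) :
    HasDerivWithinAt (fun s => EInc p (am p s q) q) (1 - q ^ 2) (Iio (K p q)) (K p q) := by
  have h := hasDerivWithinAt_comp_am hp hq (X := (EInc p · q)) (g := fun θ => 1 - q ^ 2 * sin θ ^ 2)
    (continuous_EInc hp q) (by fun_prop) fun θ hθ => by
      have hD := (modular_pos hq θ).ne'
      convert! hasDerivAt_EInc (q := q) hp hθ using 1
      rw [← modular_sq hq]
      field_simp
  simpa using h

/-- The ordinate of the wavelike curve as a function of the amplitude, up to a factor. -/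
def ordinate (p θ : ℝ) : ℝ := |cos θ| ^ (1 - 2 / p) * cos θ

lemma abs_rpow_mul_self {p : ℝ} (hp : p ≠ 0) (c : ℝ) :
    |(|c| ^ (2 / p - 1) * c)| ^ (p - 2) * (|c| ^ (2 / p - 1) * c) = |c| ^ (1 - 2 / p) * c := by
  rcases eq_or_ne c 0 with rfl | hc
  · simp
  have hc' := abs_pos.2 hc
  have h1 : |(|c| ^ (2 / p - 1) * c)| = |c| ^ (2 / p) := by
    rw [abs_mul, abs_of_pos (rpow_pos_of_pos hc' _), ← rpow_add_one hc'.ne']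
    ring_nf
  rw [h1, ← mul_assoc, ← rpow_mul hc'.le, ← rpow_add hc']
  congr 2
  field_simp
  ring

lemma wavelike_eq {p : ℝ} (hp : 1 < p) (s q : ℝ) :
    wavelike p s q = !₂[2 * EInc p (am p s q) q - s,
      -(q * (p / (p - 1))) * ordinate p (am p s q)] := by
  have h := abs_rpow_mul_self (p := p) (by linarith) (cos (am p s q))
  rw [wavelike, ordinate, ← h, cn]
  ring_nf

/-- The exponent may be negative, but the absolute value is |cos θ|^(2 - 2/p), which tends to 0 at
the zeros of the cosine. -/
lemma continuous_ordinate {p : ℝ} (hp : 1 < p) : Continuous (ordinate p) := by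
  have ha := (exponent_mem hp).1
  have h : Continuous fun c : ℝ => |c| ^ (1 - 2 / p) * c := by
    rw [continuous_iff_continuousAt]
    intro c
    rcases eq_or_ne c 0 with rfl | hc
    · have hlim : Tendsto (fun c : ℝ => |c| ^ (1 - 2 / p + 1)) (𝓝 0) (𝓝 0) := by
        have h := (continuous_abs.rpow_const (p := 1 - 2 / p + 1)
          fun _ => Or.inr (by linarith)).tendsto (0 : ℝ)
        rwa [abs_zero, zero_rpow (by linarith)] at h
      rw [ContinuousAt, mul_zero]
      refine squeeze_zero_norm (fun c => le_of_eq ?_) hlim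
      rw [norm_mul, norm_of_nonneg (rpow_nonneg (abs_nonneg c) _), norm_eq_abs]
      rcases eq_or_ne c 0 with rfl | hc
      · rw [abs_zero, mul_zero, zero_rpow (by linarith)]
      · rw [rpow_add_one (abs_pos.2 hc).ne']
    · exact (continuous_abs.continuousAt.rpow_const (Or.inl (abs_pos.2 hc).ne')).mul continuousAt_id
  exact h.comp continuous_cos

lemma hasDerivAt_ordinate {p θ : ℝ} (hθ : θ ∈ Ioo 0 (π / 2)) :
    HasDerivAt (ordinate p) (-(2 - 2 / p) * (|cos θ| ^ (1 - 2 / p) * sin θ)) θ := by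
  have hc := cos_pos_of_mem_quarter hθ
  have h := (hasDerivAt_cos_rpow (a := 1 - 2 / p) hc).neg
  have heq : ordinate p =ᶠ[𝓝 θ] fun θ => -(-(cos θ ^ (1 - 2 / p + 1))) := by
    filter_upwards [Ioo_mem_nhds hθ.1 hθ.2] with x hx
    have hx := cos_pos_of_mem_quarter hx
    rw [ordinate, neg_neg, abs_of_pos hx, rpow_add_one hx.ne']
  convert! h.congr_of_eventuallyEq heq using 1
  rw [abs_of_pos hc]
  ring

lemma hasDerivWithinAt_ordinate_am {p q : ℝ} (hp : 1 < p) (hq : q ∈ Ioo (-1 : ℝ) 1) :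
    HasDerivWithinAt (fun s => ordinate p (am p s q)) (-(2 - 2 / p) * √(1 - q ^ 2))
      (Iio (K p q)) (K p q) := by
  have h := hasDerivWithinAt_comp_am hp hq (X := ordinate p)
    (g := fun θ => -(2 - 2 / p) * (sin θ * modular q θ))
    (continuous_ordinate hp)
    (continuous_const.mul (continuous_sin.mul (continuous_modular_angle q))) fun θ hθ => by
      have hD := (modular_pos hq θ).ne'
      convert! hasDerivAt_ordinate (p := p) hθ using 1
      field_simp
  simpa [modular] using h

/-- Reflecting the derivative of an even or odd function at the right end point of a symmetric
interval to the left end point. -/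
lemma hasDerivWithinAt_reflect {f : ℝ → ℝ} {k ε L : ℝ} (hk : 0 < k)
    (hf : ∀ s ∈ Icc (-k) k, f s = ε * f (-s)) (h : HasDerivWithinAt f L (Icc (-k) k) k) :
    HasDerivWithinAt f (-ε * L) (Icc (-k) k) (-k) := by
  have hneg : HasDerivWithinAt (fun s : ℝ => -s) (-1) (Icc (-k) k) (-k) :=
    (hasDerivAt_neg (-k)).hasDerivWithinAt
  have hmaps : MapsTo (fun s : ℝ => -s) (Icc (-k) k) (Icc (-k) k) := fun s hs =>
    ⟨by linarith [hs.2], by linarith [hs.1]⟩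
  have h1 := HasDerivWithinAt.comp (h₂ := f) (h := fun s : ℝ => -s) (-k) (by rwa [neg_neg]) hneg hmaps
  have h2 := h1.const_mul ε
  have hk' : -k ∈ Icc (-k) k := ⟨le_rfl, by linarith⟩
  convert! h2.congr hf (hf _ hk') using 1
  ring

lemma hasDerivWithinAt_vec {f g : ℝ → ℝ} {f' g' x : ℝ} {s : Set ℝ}
    (hf : HasDerivWithinAt f f' s x) (hg : HasDerivWithinAt g g' s x) :
    HasDerivWithinAt (fun t => (!₂[f t, g t] : EuclideanSpace ℝ (Fin 2))) !₂[f', g'] s x := by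
  have h : HasDerivWithinAt (fun t => ![f t, g t]) ![f', g'] s x := by
    rw [hasDerivWithinAt_pi]
    intro i
    fin_cases i
    · simpa using hf
    · simpa using hg
  exact ((EuclideanSpace.equiv (Fin 2) ℝ).symm.toContinuousLinearMap.hasFDerivAt.comp_hasDerivWithinAt
    x h)

/-- The unit tangent vector of the wavelike curve at `s = ± K`, for `ε = ± 1`. -/
def endTangent (ε q : ℝ) : EuclideanSpace ℝ (Fin 2) :=
  !₂[1 - 2 * q ^ 2, ε * (2 * q * √(1 - q ^ 2))]

lemma hasDerivWithinAt_wavelike {p q : ℝ} (hp : 1 < p) (hq : q ∈ Ioo (-1 : ℝ) 1) :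
    HasDerivWithinAt (wavelike p · q) (endTangent (-1) q) (Icc (-K p q) (K p q)) (-K p q) ∧
    HasDerivWithinAt (wavelike p · q) (endTangent 1 q) (Icc (-K p q) (K p q)) (K p q) := by
  have hK := K_pos hp hq
  -- The factor p/(p-1) in the curve is what makes the tangents unit vectors.
  have hcoef : (p / (p - 1)) * (2 - 2 / p) = 2 := by
    have : p - 1 ≠ 0 := by linarith
    have : p ≠ 0 := by linarith
    field_simp
  have hE : HasDerivWithinAt (fun s => EInc p (am p s q) q) (1 - q ^ 2)
      (Icc (-K p q) (K p q)) (K p q) :=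
    (hasDerivWithinAt_EInc_am hp hq).Iic_of_Iio.mono Icc_subset_Iic_self
  have hO : HasDerivWithinAt (fun s => ordinate p (am p s q)) (-(2 - 2 / p) * √(1 - q ^ 2))
      (Icc (-K p q) (K p q)) (K p q) :=
    (hasDerivWithinAt_ordinate_am hp hq).Iic_of_Iio.mono Icc_subset_Iic_self
  have hE' := hasDerivWithinAt_reflect (ε := -1) hK (fun s hs => by
    rw [am_neg hp hq hs, EInc_neg]; ring) hE
  have hO' := hasDerivWithinAt_reflect (ε := 1) hK (fun s hs => by
    rw [am_neg hp hq hs, ordinate, ordinate, cos_neg]; ring) hO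
  simp only [wavelike_eq hp, endTangent]
  constructor
  · convert! hasDerivWithinAt_vec ((hE'.const_mul 2).sub (hasDerivWithinAt_id _ _))
      (hO'.const_mul (-(q * (p / (p - 1))))) using 1
    congr 2
    · ring
    · congr 1
      linear_combination (q * √(1 - q ^ 2)) * hcoef
  · convert! hasDerivWithinAt_vec ((hE.const_mul 2).sub (hasDerivWithinAt_id _ _))
      (hO.const_mul (-(q * (p / (p - 1))))) using 1
    congr 2
    · ring
    · congr 1
      linear_combination (-q * √(1 - q ^ 2)) * hcoef

lemma norm_endTangent {ε q : ℝ} (hε : ε ^ 2 = 1) (hq : q ∈ Ioo (-1 : ℝ) 1) :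
    ‖endTangent ε q‖ = 1 := by
  have hq2 : 0 ≤ 1 - q ^ 2 := by nlinarith [hq.1, hq.2]
  rw [EuclideanSpace.norm_eq, sqrt_eq_one]
  simp only [endTangent, Fin.sum_univ_two, norm_eq_abs, sq_abs]
  simp [mul_pow, hε, sq_sqrt hq2]
  ring

/-- With q* = sin α the tangents are (cos 2α, ±sin 2α), so their inner product is cos 4α = cos(2π -
4α). -/
lemma angle_endTangent {p : ℝ} (hp : 1 < p) :
    InnerProductGeometry.angle (endTangent (-1) (qStar p)) (endTangent 1 (qStar p))
      = 2 * phiStar p := by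
  have hq := (qStar_spec hp).1
  have hq' := Ioo_zero_one_subset hq
  have hq2 : 0 ≤ 1 - qStar p ^ 2 := by nlinarith [hq.1, hq.2]
  have hsin : sin (arcsin (qStar p)) = qStar p := sin_arcsin hq'.1.le hq'.2.le
  rw [InnerProductGeometry.angle, norm_endTangent (by norm_num) hq',
    norm_endTangent (by norm_num) hq']
  have hinner : inner ℝ (endTangent (-1) (qStar p)) (endTangent 1 (qStar p))
      = cos (2 * phiStar p) := by
    have h1 : cos (2 * phiStar p) = 2 * (1 - 2 * qStar p ^ 2) ^ 2 - 1 := by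
      rw [phiStar, cos_two_mul, cos_pi_sub, cos_two_mul, cos_sq', hsin]
      ring
    rw [h1]
    simp only [endTangent, PiLp.inner_apply, Fin.sum_univ_two]
    simp
    linear_combination (-4 * qStar p ^ 2) * sq_sqrt hq2
  -- This puts 2φ* = 2π - 4α in [0, π], where `arccos` inverts `cos`.
  have h4 : π / 4 < arcsin (qStar p) := by
    rw [lt_arcsin_iff_sin_lt ⟨by linarith [pi_pos], by linarith [pi_pos]⟩ ⟨hq'.1.le, hq'.2.le⟩,
      sin_pi_div_four]
    exact sqrt_two_div_two_lt_qStar hp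
  rw [hinner, mul_one, div_one, arccos_cos]
  · rw [phiStar]; linarith [arcsin_le_pi_div_two (qStar p)]
  · rw [phiStar]; linarith

/-! ### Half-fold figure-eights -/

lemma exists_isHalfFoldFigureEight {p : ℝ} (hp : 1 < p) :
    ∃ (a b : ℝ) (γ : ℝ → EuclideanSpace ℝ (Fin 2)), IsHalfFoldFigureEight p a b γ := by
  have hq := (qStar_spec hp).1
  have hK := K_pos hp (Ioo_zero_one_subset hq)
  have hab : 0 < 2 * K p (qStar p) := by linarith
  refine ⟨0, 2 * K p (qStar p), fun t => wavelike p (t - K p (qStar p)) (qStar p), hab,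
    qStar p, hq, (qStar_spec hp).2, 0, 1, LinearIsometryEquiv.refl ℝ _, id, one_pos,
    contDiffOn_id, fun t ht => ?_, bijOn_id _, fun t _ => by simp⟩
  rw [derivWithin_id _ _ (uniqueDiffOn_Icc hab t ht)]
  exact one_ne_zero

lemma hasDerivWithinAt_similar {p q a b t τ s₀ ε v' : ℝ} {γ : ℝ → EuclideanSpace ℝ (Fin 2)}
    {v : EuclideanSpace ℝ (Fin 2)} {c : ℝ}
    {A : EuclideanSpace ℝ (Fin 2) ≃ₗᵢ[ℝ] EuclideanSpace ℝ (Fin 2)} {σ : ℝ → ℝ}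
    (hσ : HasDerivWithinAt σ v' (Icc a b) t) (hmaps : MapsTo σ (Icc a b) (Icc 0 (2 * K p q)))
    (ht : t ∈ Icc a b) (hτ : σ t = τ) (hs₀ : s₀ = τ - K p q)
    (hγ : ∀ t ∈ Icc a b, γ t = v + c • A (wavelike p (σ t - K p q) q))
    (hw : HasDerivWithinAt (wavelike p · q) (endTangent ε q) (Icc (-K p q) (K p q)) s₀) :
    HasDerivWithinAt γ ((c * v') • A (endTangent ε q)) (Icc a b) t := by
  have hmaps' : MapsTo (fun t => σ t - K p q) (Icc a b) (Icc (-K p q) (K p q)) := fun x hx => by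
    have := hmaps hx
    exact ⟨by linarith [this.1], by linarith [this.2]⟩
  have h1 := HasDerivWithinAt.scomp (g₁ := (wavelike p · q)) (h := fun t => σ t - K p q) t
    (by rw [hτ, ← hs₀]; exact hw) (hσ.sub_const (K p q)) hmaps'
  have h2 := A.toContinuousLinearEquiv.toContinuousLinearMap.hasFDerivAt.comp_hasDerivWithinAt t h1
  have h3 := (h2.const_smul c).const_add v
  have h4 := h3.congr hγ (hγ t ht)
  convert! h4 using 1
  simp [mul_smul]

lemma tangents_of_isHalfFoldFigureEight {p a b : ℝ} {γ : ℝ → EuclideanSpace ℝ (Fin 2)}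
    (hp : 1 < p) (h : IsHalfFoldFigureEight p a b γ) :
    ∃ T₀ T₁ : EuclideanSpace ℝ (Fin 2), T₀ ≠ 0 ∧ T₁ ≠ 0 ∧
      HasDerivWithinAt γ T₀ (Icc a b) a ∧ HasDerivWithinAt γ T₁ (Icc a b) b ∧
      InnerProductGeometry.angle T₀ T₁ = 2 * phiStar p := by
  obtain ⟨hab, q, hq, hQ, v, c, A, σ, hc, hσ, hσ', hbij, hγ⟩ := h
  obtain rfl := eq_qStar hp hq hQ
  have hq' := Ioo_zero_one_subset hq
  have hK := K_pos hp hq'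
  obtain ⟨hw₀, hw₁⟩ := hasDerivWithinAt_wavelike hp hq'
  have ha : a ∈ Icc a b := left_mem_Icc.2 hab.le
  have hb : b ∈ Icc a b := right_mem_Icc.2 hab.le
  have hd : ∀ t ∈ Icc a b, HasDerivWithinAt σ (derivWithin σ (Icc a b) t) (Icc a b) t :=
    fun t ht => (hσ.differentiableOn one_ne_zero t ht).hasDerivWithinAt
  obtain ⟨t₀, ht₀, hσ₀⟩ := hbij.surjOn (left_mem_Icc.2 (by linarith : (0 : ℝ) ≤ 2 * K p (qStar p)))
  obtain ⟨t₁, ht₁, hσ₁⟩ := hbij.surjOn (right_mem_Icc.2 (by linarith : (0 : ℝ) ≤ 2 * K p (qStar p)))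
  have hA : ∀ ε : ℝ, ε ^ 2 = 1 → A (endTangent ε (qStar p)) ≠ 0 := fun ε hε h0 => by
    have := norm_endTangent hε hq'
    rw [← A.norm_map, h0, norm_zero] at this
    exact zero_ne_one this
  have hangle := angle_endTangent hp
  rw [← A.toLinearIsometry.angle_map] at hangle
  simp only [LinearIsometryEquiv.coe_toLinearIsometry] at hangle
  -- A continuous injective reparametrization is strictly monotone, so it sends endpoints to
  -- endpoints and its nonvanishing derivative has constant sign.
  rcases hσ.continuousOn.strictMonoOn_of_injOn_Icc' hab.le hbij.injOn with hm | hm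
  · have hσa : σ a = 0 := le_antisymm
      (by rw [← hσ₀]; exact hm.monotoneOn ha ht₀ ht₀.1) (hbij.mapsTo ha).1
    have hσb : σ b = 2 * K p (qStar p) := le_antisymm (hbij.mapsTo hb).2
      (by rw [← hσ₁]; exact hm.monotoneOn ht₁ hb ht₁.2)
    have hpos : ∀ t ∈ Icc a b, 0 < c * derivWithin σ (Icc a b) t := fun t ht =>
      mul_pos hc (lt_of_le_of_ne hm.monotoneOn.derivWithin_nonneg (hσ' t ht).symm)
    refine ⟨_, _, smul_ne_zero (hpos a ha).ne' (hA (-1) (by norm_num)),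
      smul_ne_zero (hpos b hb).ne' (hA 1 (by norm_num)),
      hasDerivWithinAt_similar (hd a ha) hbij.mapsTo ha hσa (by ring) hγ hw₀,
      hasDerivWithinAt_similar (hd b hb) hbij.mapsTo hb hσb (by ring) hγ hw₁, ?_⟩
    rw [InnerProductGeometry.angle_smul_left_of_pos _ _ (hpos a ha),
      InnerProductGeometry.angle_smul_right_of_pos _ _ (hpos b hb), hangle]
  -- Reversing orientation swaps the two tangents and negates both, which preserves their angle.
  · have hσa : σ a = 2 * K p (qStar p) := le_antisymm (hbij.mapsTo ha).2
      (by rw [← hσ₁]; exact hm.antitoneOn ha ht₁ ht₁.1)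
    have hσb : σ b = 0 := le_antisymm
      (by rw [← hσ₀]; exact hm.antitoneOn ht₀ hb ht₀.2) (hbij.mapsTo hb).1
    have hneg : ∀ t ∈ Icc a b, c * derivWithin σ (Icc a b) t < 0 := fun t ht =>
      mul_neg_of_pos_of_neg hc (lt_of_le_of_ne hm.antitoneOn.derivWithin_nonpos (hσ' t ht))
    refine ⟨_, _, smul_ne_zero (hneg a ha).ne (hA 1 (by norm_num)),
      smul_ne_zero (hneg b hb).ne (hA (-1) (by norm_num)),
      hasDerivWithinAt_similar (hd a ha) hbij.mapsTo ha hσa (by ring) hγ hw₁,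
      hasDerivWithinAt_similar (hd b hb) hbij.mapsTo hb hσb (by ring) hγ hw₀, ?_⟩
    rw [InnerProductGeometry.angle_smul_left_of_neg _ _ (hneg a ha),
      InnerProductGeometry.angle_smul_right_of_neg _ _ (hneg b hb),
      InnerProductGeometry.angle_neg_neg, InnerProductGeometry.angle_comm, hangle]

end PElastica

end

theorem theorem1p3 :
    -- `q*(p)` is the unique root in `(0,1)` of `2 E_{1,p} / K_{1,p} - 1`
    (∀ p : ℝ, 1 < p →
      PElastica.qStar p ∈ Set.Ioo (0 : ℝ) 1 ∧ PElastica.Q p (PElastica.qStar p) = 0 ∧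
      ∀ q ∈ Set.Ioo (0 : ℝ) 1, PElastica.Q p q = 0 → q = PElastica.qStar p) ∧
    -- half-fold figure-eight `p`-elasticae exist, and `2 φ*(p)` is the angle between the tangent
    -- vectors at the two endpoints of each of them
    (∀ p : ℝ, 1 < p →
      (∃ (a b : ℝ) (γ : ℝ → EuclideanSpace ℝ (Fin 2)),
        PElastica.IsHalfFoldFigureEight p a b γ) ∧
      ∀ (a b : ℝ) (γ : ℝ → EuclideanSpace ℝ (Fin 2)),
        PElastica.IsHalfFoldFigureEight p a b γ →
        ∃ T₀ T₁ : EuclideanSpace ℝ (Fin 2), T₀ ≠ 0 ∧ T₁ ≠ 0 ∧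
          HasDerivWithinAt γ T₀ (Set.Icc a b) a ∧
          HasDerivWithinAt γ T₁ (Set.Icc a b) b ∧
          InnerProductGeometry.angle T₀ T₁ = 2 * PElastica.phiStar p) ∧
    -- `φ*` is continuous, indeed `C¹`, and strictly decreasing from `π/2` to `0`
    ContinuousOn PElastica.phiStar (Set.Ioi 1) ∧
    ContDiffOn ℝ 1 PElastica.phiStar (Set.Ioi 1) ∧
    StrictAntiOn PElastica.phiStar (Set.Ioi 1) ∧
    Filter.Tendsto PElastica.phiStar (nhdsWithin 1 (Set.Ioi 1)) (nhds (Real.pi / 2)) ∧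
    Filter.Tendsto PElastica.phiStar Filter.atTop (nhds 0) ∧
    -- `Q_p(q)` is strictly increasing in `p`
    (∀ q ∈ Set.Ioo (0 : ℝ) 1, StrictMonoOn (fun p : ℝ => PElastica.Q p q) (Set.Ioi 1)) := by
  refine ⟨fun p hp => ⟨(PElastica.qStar_spec hp).1, (PElastica.qStar_spec hp).2,
      fun q hq => PElastica.eq_qStar hp hq⟩,
    fun p hp => ⟨PElastica.exists_isHalfFoldFigureEight hp,
      fun a b γ => PElastica.tangents_of_isHalfFoldFigureEight hp⟩,
    PElastica.contDiffOn_phiStar.continuousOn, PElastica.contDiffOn_phiStar,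
    PElastica.strictAntiOn_phiStar, PElastica.tendsto_phiStar_one,
    PElastica.tendsto_phiStar_atTop, fun q hq => PElastica.strictMonoOn_Q hq⟩
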